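/- For a partition $\pi$ of $n$, let its rank be its largest part minus its number of parts. Let $\omega(\pi)$ be the number of parts of $\pi$ equal to $1$; the crank of $\pi$ is its largest part if $\omega(\pi)=0$, and otherwise it is the number of parts of $\pi$ larger than $\omega(\pi)$, minus $\omega(\pi)$. Let $N(m,n)$ be the number of partitions of $n$ with rank $m$. For $n\neq 1$ let $M(m,n)$ be the number of partitions of $n$ with crank $m$; for $n=1$ put $M(-1,1)=1$, $M(0,1)=-1$, $M(1,1)=1$ and $M(m,1)=0$ otherwise. For $k\ge 1$ define the symmetrized rank and crank moments $$\eta_k(n)=\sum_{m=-n}^{n}\binom{m+\lfloor\frac{k-1}{2}\rfloor}{k}N(m,n),\qquad \mu_k(n)=\sum_{m=-n}^{n}\binom{m+\lfloor\frac{k-1}{2}\rfloor}{k}M(m,n),$$ where $\binom{x}{k}=x(x-1)\cdots(x-k+1)/k!$ for every integer $x$. Write $(a;q)_\infty=\prod_{i\ge 0}(1-aq^i)$. Then for every integer $k\ge 1$ the following identity of formal power series in $\mathbb{Z}[[q]]$ holds, where the multiple sum on the right converges coefficientwise: $$\sum_{n=1}^\infty\bigl(\mu_{2k}(n)-\eta_{2k}(n)\bigr)q^n=\sum_{n_k\ge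 n_{k-1}\ge\cdots\ge n_1\ge 1}\frac{q^{n_1+n_2+\cdots+n_k}}{(1-q^{n_k})^2(1-q^{n_{k-1}})^2\cdots(1-q^{n_1})^2\,(q^{n_1+1};q)_\infty}.$$ Moreover (Andrews' identity, to which the case $k=1$ reduces), for every $n\ge 1$, $$\mathrm{spt}(n)=n\,p(n)-\tfrac12 N_2(n),$$ where $p(n)$ is the number of partitions of $n$, $\mathrm{spt}(n)$ is the total number of occurrences of the smallest part in all partitions of $n$, and $N_2(n)=\sum_{m=-n}^{n}m^2N(m,n)$ is the second rank moment. -/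

import Mathlib

open PowerSeries
open scoped PowerSeries.WithPiTopology

namespace SptK

/-- Dyson's rank of a partition: the largest part minus the number of parts. -/
def rank {n : ℕ} (p : n.Partition) : ℤ :=
  (p.parts.sup : ℤ) - (Multiset.card p.parts : ℤ)

/-- The Andrews–Garvan crank of a partition. Let `ω` be the number of ones. If `ω = 0`, the crank
is the largest part; otherwise it is the number of parts larger than `ω`, minus `ω`. -/
def crank {n : ℕ} (p : n.Partition) : ℤ :=
  if p.parts.count 1 = 0 then (p.parts.sup : ℤ)
  else (Multiset.card (p.parts.filter (fun a => p.parts.count 1 < a)) : ℤ)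
    - (p.parts.count 1 : ℤ)

/-- `N(m,n)`: the number of partitions of `n` with rank `m`. -/
def N (m : ℤ) (n : ℕ) : ℤ :=
  (Fintype.card {p : n.Partition // rank p = m} : ℤ)

/-- `M(m,n)`: the number of partitions of `n` with crank `m` if `n ≠ 1`, while
`M(-1,1) = 1`, `M(0,1) = -1`, `M(1,1) = 1` and `M(m,1) = 0` otherwise. -/
def M (m : ℤ) (n : ℕ) : ℤ :=
  if n = 1 then
    if m = -1 then 1 else if m = 0 then -1 else if m = 1 then 1 else 0
  else (Fintype.card {p : n.Partition // crank p = m} : ℤ)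

/-- The symmetrized rank moment
`η_k(n) = ∑_{m=-n}^{n} binom(m + ⌊(k-1)/2⌋, k) N(m,n)`.
`Ring.choose x k` is `x(x-1)⋯(x-k+1)/k!` for every integer `x`. -/
noncomputable def eta (k n : ℕ) : ℤ :=
  ∑ m ∈ Finset.Icc (-(n : ℤ)) n, Ring.choose (m + ((k : ℤ) - 1) / 2) k * N m n

/-- The symmetrized crank moment
`μ_k(n) = ∑_{m=-n}^{n} binom(m + ⌊(k-1)/2⌋, k) M(m,n)`. -/
noncomputable def mu (k n : ℕ) : ℤ :=
  ∑ m ∈ Finset.Icc (-(n : ℤ)) n, Ring.choose (m + ((k : ℤ) - 1) / 2) k * M m n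

/-- The second rank moment `N_2(n) = ∑_{m=-n}^{n} m² N(m,n)`. -/
noncomputable def rankMomentTwo (n : ℕ) : ℤ :=
  ∑ m ∈ Finset.Icc (-(n : ℤ)) n, m ^ 2 * N m n

/-- `spt(n)`: the total number of occurrences of the smallest part, over all partitions of `n`. -/
noncomputable def spt (n : ℕ) : ℕ :=
  ∑ p : n.Partition, p.parts.count (sInf {a : ℕ | a ∈ p.parts})

/-- `(a;q)_∞ = ∏_{i ≥ 0} (1 - a q^i)` in `ℤ⟦q⟧`, an infinite product in the topology of
coefficientwise convergence. -/
noncomputable def qPochInf (a : ℤ⟦X⟧) : ℤ⟦X⟧ :=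
  ∏' i : ℕ, (1 - a * X ^ i)

/-- The index set of the multiple sum: `k`-tuples with `1 ≤ n_1 ≤ n_2 ≤ ⋯ ≤ n_k`
(the entry `n_{i+1}` is the value at `i : Fin k`). -/
abbrev Index (k : ℕ) : Type :=
  {n : Fin k → ℕ // Monotone n ∧ ∀ i, 1 ≤ n i}

/-- The summand
`q^{n_1+⋯+n_k} / ((1-q^{n_k})² ⋯ (1-q^{n_1})² (q^{n_1+1};q)_∞)` in `ℤ⟦q⟧`.
The denominator has constant coefficient `1`, and `invOfUnit _ 1` is its inverse. -/
noncomputable def summand {k : ℕ} (hk : 1 ≤ k) (n : Index k) : ℤ⟦X⟧ :=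
  X ^ (∑ i, n.1 i) *
    invOfUnit ((∏ i, (1 - X ^ (n.1 i)) ^ 2) * qPochInf (X ^ (n.1 ⟨0, hk⟩ + 1))) 1

end SptK

/-! Write R and C for the generating functions of rank and crank in z, and T_n = (q^{n+1})_∞² /
((zq^{n+1})_∞ (z⁻¹q^{n+1})_∞), with (a)_∞ = (a;q)_∞. Here T_0 = (q)_∞ C and T_n → 1. Heine's
transformation (`hasSum_heine`) gives R - 1 = ∑ q^{n+1} T_n / (q^{n+1})_∞, and telescoping T_n /
(q^{n+1})_∞ turns this into C - R = ∑ (T_n - T_{n+1}) / (q^{n+2})_∞ (`hasSum_crankTail_sub`).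
Moreover T_n - T_{n+1} = (z - 2 + z⁻¹) q^{n+1} / (1 - q^{n+1})² · T_n (`crankTail_sub_succ`).

Now put z = 1 + ε. The coefficient of ε^{2k} in z^{k-1} z^m is the binomial weight of the
symmetrized moment, and z(z - 2 + z⁻¹) = ε², so each factor z - 2 + z⁻¹ lowers k by one
(`extract_secondDiff_mul`). Applied repeatedly to the T_n, this produces the complete homogeneous
sums of q^m / (1 - q^m)² over m > n (`hasSum_tailMoment`). Applied once more to C - R, it yields the
multiple sum.

For k = 1 the sum counts smallest parts, so spt = μ_2 - η_2. Applying the extraction to C = T_0 /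
(q)_∞ gives μ_2(n) = n p(n) (`mu_two`). Since the ranks of the partitions of n add up to 0, 2η_2 =
N_2 (`two_mul_eta_two`). -/

namespace SptK

open Filter Topology Finset

/-! ### Coefficientwise convergence through divisibility by powers of X. -/

section Convergence

variable {R : Type*} [CommRing R]

theorem eq_of_forall_X_pow_dvd_sub {a b : R⟦X⟧} (h : ∀ N, X ^ N ∣ a - b) : a = b := by
  ext d
  have := X_pow_dvd_iff.1 (h (d + 1)) d (Nat.lt_succ_self d)
  rwa [map_sub, sub_eq_zero] at this

variable [TopologicalSpace R]

theorem tendsto_of_X_pow_dvd_sub {s : ℕ → R⟦X⟧} {a : R⟦X⟧} (h : ∀ N, X ^ N ∣ s N - a) :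
    Tendsto s atTop (𝓝 a) := by
  rw [WithPiTopology.tendsto_iff_coeff_tendsto]
  refine fun d ↦ tendsto_atTop_of_eventually_const (i₀ := d + 1) fun n hn ↦ ?_
  have := X_pow_dvd_iff.1 (h n) d hn
  rwa [map_sub, sub_eq_zero] at this

theorem X_pow_dvd_sub_of_tendsto [T2Space R] {s : ℕ → R⟦X⟧} {a b : R⟦X⟧} {N : ℕ}
    (hs : Tendsto s atTop (𝓝 a)) (h : ∀ᶠ n in atTop, X ^ N ∣ s n - b) : X ^ N ∣ a - b := by
  rw [X_pow_dvd_iff]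
  intro m hm
  rw [map_sub, sub_eq_zero]
  have h1 := (WithPiTopology.tendsto_iff_coeff_tendsto R _ _ _).1 hs m
  refine tendsto_nhds_unique h1 (tendsto_const_nhds.congr' ?_)
  filter_upwards [h] with n hn
  have := X_pow_dvd_iff.1 hn m hm
  rw [map_sub, sub_eq_zero] at this
  exact this.symm

theorem summable_of_X_pow_dvd {ι : Type*} {f : ι → R⟦X⟧} (wt : ι → ℕ)
    (hwt : ∀ d, {i | wt i ≤ d}.Finite) (h : ∀ i, X ^ wt i ∣ f i) : Summable f := by
  rw [WithPiTopology.summable_iff_summable_coeff]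
  refine fun d ↦ summable_of_hasFiniteSupport ((hwt d).subset fun i hi ↦ ?_)
  by_contra hlt
  exact hi (X_pow_dvd_iff.1 (h i) d (not_le.1 hlt))

theorem summable_nat_of_X_pow_dvd {f : ℕ → R⟦X⟧} (h : ∀ n, X ^ n ∣ f n) : Summable f :=
  summable_of_X_pow_dvd id (fun d ↦ Set.finite_le_nat d) h

theorem hasSum_of_tendsto [T2Space R] {f : ℕ → R⟦X⟧} {a : R⟦X⟧} (h : ∀ n, X ^ n ∣ f n)
    (ha : Tendsto (fun N ↦ ∑ n ∈ range N, f n) atTop (𝓝 a)) : HasSum f a := by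
  have hs := (summable_nat_of_X_pow_dvd h).hasSum
  rwa [tendsto_nhds_unique hs.tendsto_sum_nat ha] at hs

theorem hasSum_of_X_pow_dvd_sub [T2Space R] {f : ℕ → R⟦X⟧} {a : R⟦X⟧} (h : ∀ n, X ^ n ∣ f n)
    (ha : ∀ N, X ^ N ∣ ∑ n ∈ range N, f n - a) : HasSum f a :=
  hasSum_of_tendsto h (tendsto_of_X_pow_dvd_sub ha)

theorem multipliable_of_X_pow_dvd_sub {φ : ℕ → R⟦X⟧} (h : ∀ n, X ^ n ∣ φ n - 1) :
    Multipliable φ := by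
  have : φ = fun n ↦ 1 + (φ n - 1) := by ext1 n; ring
  rw [this]
  apply WithPiTopology.multipliable_one_add_of_tendsto_order_atTop_nhds_top
  refine ENat.tendsto_nhds_top_iff_natCast_lt.mpr fun n ↦ eventually_atTop.mpr ⟨n + 1, ?_⟩
  intro m hm
  refine lt_of_lt_of_le (b := (m : ℕ∞)) (by exact_mod_cast hm) ?_
  exact nat_le_order _ _ fun i hi ↦ X_pow_dvd_iff.1 (h m) i hi

end Convergence

/-! ### Inverses of power series with constant coefficient 1. -/

section Reciprocal

variable {R : Type*} [CommRing R]

/-- The reciprocal of a power series with constant coefficient `1`. -/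
noncomputable def recip (f : R⟦X⟧) : R⟦X⟧ := invOfUnit f 1

theorem mul_recip {f : R⟦X⟧} (hf : constantCoeff f = 1) : f * recip f = 1 :=
  mul_invOfUnit f 1 (by simpa using hf)

theorem eq_mul_recip {a b f : R⟦X⟧} (hf : constantCoeff f = 1) (h : a * f = b) :
    a = b * recip f := by
  linear_combination (-a) * mul_recip hf + recip f * h

theorem recip_mul {f g : R⟦X⟧} (hf : constantCoeff f = 1) (hg : constantCoeff g = 1) :
    recip (f * g) = recip f * recip g := by
  have h : constantCoeff (f * g) = 1 := by simp [hf, hg]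
  linear_combination (-recip (f * g)) * mul_recip hf - recip (f * g) * f * recip f * mul_recip hg
    + recip f * recip g * mul_recip h

theorem map_recip {S : Type*} [CommRing S] (φ : R →+* S) {f : R⟦X⟧} (hf : constantCoeff f = 1) :
    PowerSeries.map φ (recip f) = recip (PowerSeries.map φ f) := by
  have h1 : constantCoeff (PowerSeries.map φ f) = 1 := by
    rw [← coeff_zero_eq_constantCoeff_apply, coeff_map, coeff_zero_eq_constantCoeff_apply, hf,
      map_one]
  have h2 := congrArg (PowerSeries.map φ) (mul_recip hf)
  rw [map_mul, map_one] at h2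
  rw [← one_mul (recip (PowerSeries.map φ f))]
  exact eq_mul_recip h1 (by rw [mul_comm, h2])

theorem constantCoeff_one_sub {f : R⟦X⟧} (hf : constantCoeff f = 0) :
    constantCoeff (1 - f) = 1 := by simp [hf]

@[simp]
theorem constantCoeff_one_sub_mul_X_pow (c : R⟦X⟧) (n : ℕ) :
    constantCoeff (1 - c * X ^ (n + 1)) = 1 := by simp

@[simp]
theorem constantCoeff_one_sub_X_pow (n : ℕ) :
    constantCoeff (1 - (X : R⟦X⟧) ^ (n + 1)) = 1 := by simp

end Reciprocal

/-! ### The q-binomial theorem and Heine's transformation. -/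

section QSeries

variable {R : Type*} [CommRing R]

/-- The finite `q`-Pochhammer product `(cq; q)_n`. -/
noncomputable def qp (c : R⟦X⟧) (n : ℕ) : R⟦X⟧ := ∏ i ∈ range n, (1 - c * X ^ (i + 1))

@[simp]
theorem qp_zero (c : R⟦X⟧) : qp c 0 = 1 := by simp [qp]

theorem qp_succ (c : R⟦X⟧) (n : ℕ) : qp c (n + 1) = qp c n * (1 - c * X ^ (n + 1)) :=
  prod_range_succ _ _

theorem qp_add (c : R⟦X⟧) (n k : ℕ) : qp c (n + k) = qp c n * qp (c * X ^ n) k := by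
  rw [qp, prod_range_add]
  congr 1
  exact prod_congr rfl fun i _ ↦ by ring

@[simp]
theorem constantCoeff_qp (c : R⟦X⟧) (n : ℕ) : constantCoeff (qp c n) = 1 := by
  rw [qp, map_prod]
  exact prod_eq_one fun i _ ↦ constantCoeff_one_sub_mul_X_pow c i

theorem X_pow_dvd_qp_sub_one (c : R⟦X⟧) (s n : ℕ) : X ^ (s + 1) ∣ qp (c * X ^ s) n - 1 := by
  induction n with
  | zero => simp
  | succ n ih =>
    rw [qp_succ, show ∀ a b : R⟦X⟧, a * (1 - b) - 1 = (a - 1) - a * b by intros; ring]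
    exact dvd_sub ih (Dvd.intro (qp (c * X ^ s) n * c * X ^ n) (by ring))

/-- A sequence divisible by growing powers of `X`, each term a multiple of the next, vanishes. -/
theorem eq_zero_of_eq_mul_succ {G m : ℕ → R⟦X⟧} (h : ∀ s, G s = m s * G (s + 1))
    (hG : ∀ s, X ^ s ∣ G s) (s : ℕ) : G s = 0 := by
  have key : ∀ k s, G (s + k) ∣ G s := by
    intro k
    induction k with
    | zero => simp
    | succ k ih =>
      intro s
      have := ih (s + 1)
      rw [show s + 1 + k = s + (k + 1) by ring] at this
      exact this.trans (Dvd.intro_left _ (h s).symm)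
  apply eq_of_forall_X_pow_dvd_sub
  intro N
  rw [sub_zero]
  exact ((pow_dvd_pow X (Nat.le_add_left N s)).trans (hG (s + N))).trans (key N s)

/-- The coefficients of the `q`-binomial series. -/
noncomputable def qbinomCoeff (a : R⟦X⟧) (n : ℕ) : R⟦X⟧ := qp a n * recip (qp 1 n)

theorem qbinomCoeff_succ (a : R⟦X⟧) (n : ℕ) :
    qbinomCoeff a (n + 1) * (1 - X ^ (n + 1)) = qbinomCoeff a n * (1 - a * X ^ (n + 1)) := by
  have h1 := mul_recip (constantCoeff_qp (1 : R⟦X⟧) n)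
  have h2 := mul_recip (constantCoeff_qp (1 : R⟦X⟧) (n + 1))
  unfold qbinomCoeff
  rw [qp_succ a]
  rw [qp_succ 1] at h2 ⊢
  set y := recip (qp (1 : R⟦X⟧) n * (1 - 1 * X ^ (n + 1)))
  linear_combination qp a n * (1 - a * X ^ (n + 1)) * recip (qp 1 n) * h2
    - qp a n * (1 - a * X ^ (n + 1)) * y * (1 - X ^ (n + 1)) * h1

/-- Truncation of the functional equation (1 - tq) F(t) = (1 - atq²) F(tq). Comparing powers of t
gives the recurrence `qbinomCoeff_succ`, and the boundary term is divisible by X^N. -/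
theorem qbinom_partial (a t : R⟦X⟧) (N : ℕ) :
    (1 - t * X) * ∑ n ∈ range N, qbinomCoeff a n * (t * X) ^ n
      - (1 - a * t * X ^ 2) * ∑ n ∈ range N, qbinomCoeff a n * (t * X * X) ^ n
      = - ((t * X) ^ N * qbinomCoeff a N * (1 - X ^ N)) := by
  induction N with
  | zero => simp
  | succ N ih =>
    rw [sum_range_succ, sum_range_succ]
    linear_combination ih + (t * X) ^ (N + 1) * qbinomCoeff_succ a N

variable [TopologicalSpace R]

/-- The infinite `q`-Pochhammer product `(cq; q)_∞`. -/
noncomputable def qpInf (c : R⟦X⟧) : R⟦X⟧ := ∏' i : ℕ, (1 - c * X ^ (i + 1))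

theorem multipliable_qpInf (c : R⟦X⟧) : Multipliable fun i : ℕ ↦ (1 - c * X ^ (i + 1)) :=
  multipliable_of_X_pow_dvd_sub fun n ↦ Dvd.intro (-(c * X)) (by ring)

theorem qPochInf_eq_qpInf (n : ℕ) : qPochInf (X ^ (n + 1)) = qpInf (X ^ n) := by
  unfold qPochInf qpInf
  congr 1
  ext1 i
  ring

theorem tendsto_qp (c : R⟦X⟧) : Tendsto (qp c) atTop (𝓝 (qpInf c)) :=
  (multipliable_qpInf c).hasProd.tendsto_prod_nat

@[simp]
theorem qpInf_zero : qpInf (0 : R⟦X⟧) = 1 := by simp [qpInf]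

theorem summable_qbinom (a t : R⟦X⟧) : Summable fun n ↦ qbinomCoeff a n * (t * X) ^ n :=
  summable_nat_of_X_pow_dvd fun n ↦ Dvd.intro_left (qbinomCoeff a n * t ^ n) (by ring)

/-- The generating function of the rank over nonempty partitions, by largest part. -/
noncomputable def rankSeries (z w : R⟦X⟧) : R⟦X⟧ :=
  ∑' n : ℕ, z ^ n * X ^ (n + 1) * recip (qp w (n + 1))

theorem hasSum_rankSeries (z w : R⟦X⟧) :
    HasSum (fun n : ℕ ↦ z ^ n * X ^ (n + 1) * recip (qp w (n + 1))) (rankSeries z w) :=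
  (summable_nat_of_X_pow_dvd fun n ↦
    Dvd.intro_left (z ^ n * X * recip (qp w (n + 1))) (by ring)).hasSum

variable [T2Space R]

theorem X_pow_dvd_qpInf_sub_one (c : R⟦X⟧) (s : ℕ) : X ^ (s + 1) ∣ qpInf (c * X ^ s) - 1 :=
  X_pow_dvd_sub_of_tendsto (tendsto_qp _) (.of_forall fun n ↦ X_pow_dvd_qp_sub_one c s n)

@[simp]
theorem constantCoeff_qpInf (c : R⟦X⟧) : constantCoeff (qpInf c) = 1 := by
  have := X_pow_dvd_iff.1 (X_pow_dvd_qpInf_sub_one c 0) 0 one_pos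
  simpa [sub_eq_zero] using this

theorem X_pow_dvd_qbinom_sub_one (a t : R⟦X⟧) (s : ℕ) :
    X ^ s ∣ ∑' n, qbinomCoeff a n * (t * X ^ s * X) ^ n - 1 := by
  refine X_pow_dvd_sub_of_tendsto (summable_qbinom a (t * X ^ s)).hasSum.tendsto_sum_nat
    (eventually_atTop.2 ⟨1, fun n hn ↦ ?_⟩)
  obtain ⟨k, rfl⟩ := Nat.exists_eq_add_of_le' hn
  have h0 : qbinomCoeff a 0 = 1 := by
    have := mul_recip (f := (1 : R⟦X⟧)) (by simp)
    simpa [qbinomCoeff] using this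
  rw [sum_range_succ', h0]
  simp only [pow_zero, mul_one, add_sub_cancel_right]
  exact dvd_sum fun i _ ↦
    Dvd.intro (qbinomCoeff a (i + 1) * t * X * (t * X ^ s * X) ^ i) (by ring)

variable [IsTopologicalRing R]

theorem qpInf_eq_qp_mul (c : R⟦X⟧) (n : ℕ) : qpInf c = qp c n * qpInf (c * X ^ n) := by
  have h1 := ((tendsto_qp (c * X ^ n)).const_mul (qp c n))
  have h2 := (tendsto_add_atTop_iff_nat n).2 (tendsto_qp c)
  refine tendsto_nhds_unique h2 (h1.congr fun k ↦ ?_)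
  rw [← qp_add, add_comm]

theorem qpInf_mul_X_pow (c : R⟦X⟧) (n : ℕ) :
    qpInf (c * X ^ n) = (1 - c * X ^ (n + 1)) * qpInf (c * X ^ (n + 1)) := by
  rw [qpInf_eq_qp_mul _ 1, qp_succ, qp_zero]
  ring_nf

theorem qbinom_functional (a t : R⟦X⟧) :
    (1 - t * X) * ∑' n, qbinomCoeff a n * (t * X) ^ n
      = (1 - a * t * X ^ 2) * ∑' n, qbinomCoeff a n * (t * X * X) ^ n := by
  have h1 := (summable_qbinom a t).hasSum.tendsto_sum_nat.const_mul (1 - t * X)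
  have h2 := (summable_qbinom a (t * X)).hasSum.tendsto_sum_nat.const_mul (1 - a * t * X ^ 2)
  refine sub_eq_zero.1 (tendsto_nhds_unique (h1.sub h2) (tendsto_of_X_pow_dvd_sub fun N ↦ ?_))
  rw [qbinom_partial]
  exact Dvd.intro_left (-(t ^ N * qbinomCoeff a N * (1 - X ^ N))) (by ring)

/-- The `q`-binomial theorem. -/
theorem hasSum_qbinom (a t : R⟦X⟧) :
    HasSum (fun n ↦ qbinomCoeff a n * (t * X) ^ n) (qpInf (a * t * X) * recip (qpInf t)) := by
  suffices h : (∑' n, qbinomCoeff a n * (t * X) ^ n) * qpInf t = qpInf (a * t * X) by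
    rw [← eq_mul_recip (constantCoeff_qpInf t) h]
    exact (summable_qbinom a t).hasSum
  let F : ℕ → R⟦X⟧ := fun s ↦ ∑' n, qbinomCoeff a n * (t * X ^ s * X) ^ n
  let G : ℕ → R⟦X⟧ := fun s ↦ F s * qpInf (t * X ^ s) - qpInf (a * t * X * X ^ s)
  -- Both sides obey the same functional equation under t ↦ tq, and both are 1 modulo X^s at tq^s,
  -- so their difference vanishes.
  have hG : G 0 = 0 := by
    refine eq_zero_of_eq_mul_succ (m := fun s ↦ 1 - a * t * X * X ^ (s + 1)) (fun s ↦ ?_)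
      (fun s ↦ ?_) 0
    · have h1 := qbinom_functional a (t * X ^ s)
      rw [show t * X ^ s * X * X = t * X ^ (s + 1) * X by ring] at h1
      change (1 - t * X ^ s * X) * F s = (1 - a * (t * X ^ s) * X ^ 2) * F (s + 1) at h1
      simp only [G]
      rw [qpInf_mul_X_pow t s, qpInf_mul_X_pow (a * t * X) s]
      linear_combination qpInf (t * X ^ (s + 1)) * h1
    · have h1 : X ^ s ∣ F s - 1 := X_pow_dvd_qbinom_sub_one a t s
      have h2 := (pow_dvd_pow X (Nat.le_succ s)).trans (X_pow_dvd_qpInf_sub_one t s)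
      have h3 := (pow_dvd_pow X (Nat.le_succ s)).trans (X_pow_dvd_qpInf_sub_one (a * t * X) s)
      have : G s = (F s - 1) * qpInf (t * X ^ s) + (qpInf (t * X ^ s) - 1)
        - (qpInf (a * t * X * X ^ s) - 1) := by simp only [G]; ring
      rw [this]
      exact dvd_sub (dvd_add (h1.mul_right _) h2) h3
  simpa [G, F, sub_eq_zero] using hG

/-- The q-binomial theorem with a = 0 expands 1/(zq^{n+1})_∞, and (zq)_∞ / (zq^{n+1})_∞ = (zq)_n. -/
theorem hasSum_heine_row (z w : R⟦X⟧) (n : ℕ) :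
    HasSum (fun m ↦ qpInf z * qbinomCoeff w n * X ^ (n + 1) *
      (qbinomCoeff 0 m * (z * X ^ n * X) ^ m)) (qp z n * qbinomCoeff w n * X ^ (n + 1)) := by
  have h1 : HasSum (fun m ↦ qbinomCoeff 0 m * (z * X ^ n * X) ^ m)
      (recip (qpInf (z * X ^ n))) := by
    have h := hasSum_qbinom 0 (z * X ^ n)
    rwa [show (0 : R⟦X⟧) * (z * X ^ n) * X = 0 by ring, qpInf_zero, one_mul] at h
  have h2 : qp z n * qbinomCoeff w n * X ^ (n + 1) = qpInf z * qbinomCoeff w n * X ^ (n + 1) *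
      recip (qpInf (z * X ^ n)) := by
    rw [qpInf_eq_qp_mul z n]
    linear_combination (-qp z n * qbinomCoeff w n * X ^ (n + 1)) *
      mul_recip (constantCoeff_qpInf (z * X ^ n))
  rw [h2]
  exact h1.mul_left _

/-- The powers of q regroup as q^{m+1} (q^{m+1})^n, so the q-binomial theorem applies with t = q^m.
-/
theorem hasSum_heine_col (z w : R⟦X⟧) (m : ℕ) :
    HasSum (fun n ↦ qpInf z * qbinomCoeff w n * X ^ (n + 1) *
      (qbinomCoeff 0 m * (z * X ^ n * X) ^ m))
      (qpInf z * qpInf w * recip (qpInf 1) * (z ^ m * X ^ (m + 1) * recip (qp w (m + 1)))) := by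
  have e1 := qpInf_eq_qp_mul w (m + 1)
  have e2 := qpInf_eq_qp_mul (1 : R⟦X⟧) m
  rw [one_mul] at e2
  have r1 := mul_recip (constantCoeff_qp w (m + 1))
  have r2 := recip_mul (constantCoeff_qp (1 : R⟦X⟧) m) (constantCoeff_qpInf (X ^ m))
  rw [← e2] at r2
  have h0 : qp (0 : R⟦X⟧) m = 1 := by simp [qp]
  have h2 : qpInf z * qpInf w * recip (qpInf 1) * (z ^ m * X ^ (m + 1) * recip (qp w (m + 1)))
      = qpInf z * qbinomCoeff 0 m * z ^ m * X ^ (m + 1) *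
        (qpInf (w * X ^ m * X) * recip (qpInf (X ^ m))) := by
    rw [r2, qbinomCoeff, h0, e1, show w * X ^ m * X = w * X ^ (m + 1) by ring]
    linear_combination (qpInf z * qpInf (w * X ^ (m + 1)) * recip (qp 1 m) *
      recip (qpInf (X ^ m)) * z ^ m * X ^ (m + 1)) * r1
  have h3 : (fun n ↦ qpInf z * qbinomCoeff w n * X ^ (n + 1) *
      (qbinomCoeff 0 m * (z * X ^ n * X) ^ m)) = fun n ↦
      qpInf z * qbinomCoeff 0 m * z ^ m * X ^ (m + 1) * (qbinomCoeff w n * (X ^ m * X) ^ n) := by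
    ext1 n
    ring
  rw [h2, h3]
  exact (hasSum_qbinom w (X ^ m)).mul_left _

/-- A case of the Heine transformation. -/
theorem hasSum_heine (z w : R⟦X⟧) :
    HasSum (fun n ↦ qp z n * qbinomCoeff w n * X ^ (n + 1))
      (qpInf z * qpInf w * recip (qpInf 1) * rankSeries z w) := by
  -- One double series, summed by rows and by columns.
  let f : ℕ × ℕ → R⟦X⟧ := fun p ↦
    qpInf z * qbinomCoeff w p.1 * X ^ (p.1 + 1) *
      (qbinomCoeff 0 p.2 * (z * X ^ p.1 * X) ^ p.2)
  have hf : Summable f := by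
    refine summable_of_X_pow_dvd (fun p ↦ p.1 + p.2) (fun d ↦ ?_) fun p ↦ ?_
    · refine ((Set.finite_le_nat d).prod (Set.finite_le_nat d)).subset fun p hp ↦ ?_
      simp only [Set.mem_ofPred_eq, Set.mem_prod] at hp ⊢
      omega
    · refine Dvd.intro_left (qpInf z * qbinomCoeff w p.1 * X *
        (qbinomCoeff 0 p.2 * (z * X ^ p.1) ^ p.2)) ?_
      simp only [f]
      ring
  have h1 := hf.hasSum.prod_fiberwise (hasSum_heine_row z w)
  have h2 := ((Equiv.prodComm ℕ ℕ).hasSum_iff.2 hf.hasSum).prod_fiberwise (hasSum_heine_col z w)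
  rwa [h2.unique ((hasSum_rankSeries z w).mul_left _)] at h1

end QSeries

/-! ### The crank product, its tails and the telescoping formula for crank minus rank. -/

section RankCrank

theorem hasSum_of_eq {α ι : Type*} [AddCommMonoid α] [TopologicalSpace α] {f g : ι → α} {a b : α}
    (h : HasSum f a) (hf : ∀ i, g i = f i) (hb : b = a) : HasSum g b := by
  rw [hb, funext hf]
  exact h

variable {R : Type*} [CommRing R]

theorem X_pow_dvd_recip_sub_one {f : R⟦X⟧} {N : ℕ} (hf : constantCoeff f = 1)
    (h : X ^ N ∣ f - 1) : X ^ N ∣ recip f - 1 := by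
  have : recip f - 1 = -(f - 1) * recip f := by linear_combination mul_recip hf
  rw [this]
  exact (h.neg_right).mul_right _

theorem X_pow_dvd_mul_sub_one {f g : R⟦X⟧} {N : ℕ} (hf : X ^ N ∣ f - 1) (hg : X ^ N ∣ g - 1) :
    X ^ N ∣ f * g - 1 := by
  rw [show f * g - 1 = (f - 1) * g + (g - 1) by ring]
  exact dvd_add (hf.mul_right _) hg

/-- `qp X n` is (q²;q)_n, the product without the factor of parts equal to 1, which the crank treats
separately. -/
theorem one_sub_X_mul_recip_qp (n : ℕ) :
    (1 - X) * recip (qp (1 : R⟦X⟧) (n + 1)) = recip (qp X n) := by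
  have h1 : qp (1 : R⟦X⟧) (n + 1) = (1 - X) * qp X n := by
    rw [add_comm, qp_add, qp_succ, qp_zero]
    simp
  have h2 : constantCoeff (1 - X : R⟦X⟧) = 1 := by simp
  rw [h1, recip_mul h2 (constantCoeff_qp _ _), ← mul_assoc, mul_recip h2, one_mul]

theorem recip_one : recip (1 : R⟦X⟧) = 1 := by
  simpa using mul_recip (f := (1 : R⟦X⟧)) (by simp)

theorem qbinomCoeff_zero_left (n : ℕ) : qbinomCoeff (0 : R⟦X⟧) n = recip (qp 1 n) := by
  simp [qbinomCoeff, qp]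

variable [TopologicalSpace R]

/-- The product `(q; q)_∞ / ((zq; q)_∞ (wq; q)_∞)`, the generating function of the crank when
`z * w = 1`. -/
noncomputable def crankSeries (z w : R⟦X⟧) : R⟦X⟧ :=
  qpInf 1 * recip (qpInf z) * recip (qpInf w)

/-- The product `(q^{n+1}; q)_∞² / ((zq^{n+1}; q)_∞ (wq^{n+1}; q)_∞)`. -/
noncomputable def crankTail (z w : R⟦X⟧) (n : ℕ) : R⟦X⟧ :=
  qpInf (X ^ n) ^ 2 * recip (qpInf (z * X ^ n)) * recip (qpInf (w * X ^ n))

theorem crankTail_zero (z w : R⟦X⟧) : crankTail z w 0 = qpInf 1 * crankSeries z w := by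
  simp only [crankTail, crankSeries, pow_zero, mul_one]
  ring

variable [T2Space R]

theorem X_pow_dvd_recip_qpInf_sub_one (c : R⟦X⟧) (n : ℕ) :
    X ^ n ∣ recip (qpInf (c * X ^ n)) - 1 :=
  X_pow_dvd_recip_sub_one (constantCoeff_qpInf _)
    ((pow_dvd_pow X n.le_succ).trans (X_pow_dvd_qpInf_sub_one c n))

theorem X_pow_dvd_qpInf_X_pow_sub_one (n : ℕ) : X ^ n ∣ qpInf (X ^ n : R⟦X⟧) - 1 := by
  have := (pow_dvd_pow X n.le_succ).trans (X_pow_dvd_qpInf_sub_one (1 : R⟦X⟧) n)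
  rwa [one_mul] at this

theorem X_pow_dvd_crankTail_sub_one (z w : R⟦X⟧) (n : ℕ) : X ^ n ∣ crankTail z w n - 1 := by
  refine X_pow_dvd_mul_sub_one (X_pow_dvd_mul_sub_one ?_ (X_pow_dvd_recip_qpInf_sub_one z n))
    (X_pow_dvd_recip_qpInf_sub_one w n)
  rw [pow_two]
  exact X_pow_dvd_mul_sub_one (X_pow_dvd_qpInf_X_pow_sub_one n) (X_pow_dvd_qpInf_X_pow_sub_one n)

variable [IsTopologicalRing R]

theorem qpInf_X_pow (n : ℕ) :
    qpInf (X ^ n : R⟦X⟧) = (1 - X ^ (n + 1)) * qpInf (X ^ (n + 1)) := by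
  simpa using qpInf_mul_X_pow (1 : R⟦X⟧) n

theorem recip_qpInf_mul_X_pow (c : R⟦X⟧) (n : ℕ) :
    recip (qpInf (c * X ^ n)) * (1 - c * X ^ (n + 1)) = recip (qpInf (c * X ^ (n + 1))) := by
  have h := recip_mul (constantCoeff_one_sub_mul_X_pow c n)
    (constantCoeff_qpInf (c * X ^ (n + 1)))
  rw [← qpInf_mul_X_pow] at h
  rw [h]
  linear_combination recip (qpInf (c * X ^ (n + 1))) *
    mul_recip (constantCoeff_one_sub_mul_X_pow c n)

theorem crankTail_succ (z w : R⟦X⟧) (n : ℕ) :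
    crankTail z w (n + 1) * (1 - X ^ (n + 1)) ^ 2
      = crankTail z w n * ((1 - z * X ^ (n + 1)) * (1 - w * X ^ (n + 1))) := by
  simp only [crankTail]
  rw [← recip_qpInf_mul_X_pow z n, ← recip_qpInf_mul_X_pow w n, qpInf_X_pow n]
  ring

/-- With x = q^{n+1} and zw = 1, (1 - x)² - (1 - zx)(1 - wx) = (z - 2 + w)x. -/
theorem crankTail_sub_succ {z w : R⟦X⟧} (hzw : z * w = 1) (n : ℕ) :
    crankTail z w n - crankTail z w (n + 1) =
      (z - 2 + w) * (X ^ (n + 1) * recip ((1 - X ^ (n + 1)) ^ 2)) * crankTail z w n := by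
  have h1 : constantCoeff ((1 - (X : R⟦X⟧) ^ (n + 1)) ^ 2) = 1 := by simp
  have h2 := mul_recip h1
  linear_combination (-recip ((1 - (X : R⟦X⟧) ^ (n + 1)) ^ 2)) * crankTail_succ z w n
    - (crankTail z w n - crankTail z w (n + 1)) * h2 -
    crankTail z w n * recip ((1 - (X : R⟦X⟧) ^ (n + 1)) ^ 2) * X ^ (2 * (n + 1)) * hzw

theorem crankSeries_mul_qp (z w : R⟦X⟧) (n : ℕ) :
    crankSeries z w * (qp z n * qbinomCoeff w n) =
      qpInf (X ^ n) * recip (qpInf (z * X ^ n)) * recip (qpInf (w * X ^ n)) := by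
  have e1 := qpInf_eq_qp_mul (1 : R⟦X⟧) n
  rw [one_mul] at e1
  have ez : recip (qpInf z) = recip (qp z n) * recip (qpInf (z * X ^ n)) := by
    rw [← recip_mul (constantCoeff_qp _ _) (constantCoeff_qpInf _), ← qpInf_eq_qp_mul]
  have ew : recip (qpInf w) = recip (qp w n) * recip (qpInf (w * X ^ n)) := by
    rw [← recip_mul (constantCoeff_qp _ _) (constantCoeff_qpInf _), ← qpInf_eq_qp_mul]
  have r1 := mul_recip (constantCoeff_qp (1 : R⟦X⟧) n)
  have rz := mul_recip (constantCoeff_qp z n)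
  have r2 := mul_recip (constantCoeff_qp w n)
  rw [crankSeries, e1, ez, ew, qbinomCoeff]
  set A := qpInf (X ^ n : R⟦X⟧) * recip (qpInf (z * X ^ n)) * recip (qpInf (w * X ^ n)) with hA
  calc _ = (qp 1 n * recip (qp 1 n)) * (qp z n * recip (qp z n)) * (qp w n * recip (qp w n)) * A
        := by rw [hA]; ring
    _ = A := by rw [r1, rz, r2]; ring

theorem crankTail_mul_recip (z w : R⟦X⟧) (n : ℕ) :
    crankTail z w n * recip (qpInf (X ^ n)) = crankSeries z w * (qp z n * qbinomCoeff w n) := by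
  rw [crankSeries_mul_qp, crankTail]
  linear_combination qpInf (X ^ n) * recip (qpInf (z * X ^ n)) * recip (qpInf (w * X ^ n)) *
    mul_recip (constantCoeff_qpInf (X ^ n : R⟦X⟧))

theorem crankTail_mul_recip_succ (z w : R⟦X⟧) (n : ℕ) :
    crankTail z w n * recip (qpInf (X ^ (n + 1))) =
      (1 - X ^ (n + 1)) * (crankTail z w n * recip (qpInf (X ^ n))) := by
  have h := recip_qpInf_mul_X_pow (1 : R⟦X⟧) n
  simp only [one_mul] at h
  linear_combination (-crankTail z w n) * h

/-- The prefactor in Heine's transformation is the inverse of `crankSeries`, so multiplying by the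
latter isolates the rank series. -/
theorem hasSum_X_pow_mul_crankTail (z w : R⟦X⟧) :
    HasSum (fun n ↦ X ^ (n + 1) * (crankTail z w n * recip (qpInf (X ^ n))))
      (rankSeries z w) := by
  have h1 := (hasSum_heine z w).mul_left (crankSeries z w)
  have h2 : crankSeries z w * (qpInf z * qpInf w * recip (qpInf 1) * rankSeries z w)
      = rankSeries z w := by
    rw [crankSeries]
    calc _ = (qpInf 1 * recip (qpInf 1)) * (qpInf z * recip (qpInf z)) *
          (qpInf w * recip (qpInf w)) * rankSeries z w := by ring
      _ = _ := by
        rw [mul_recip (constantCoeff_qpInf _), mul_recip (constantCoeff_qpInf _),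
          mul_recip (constantCoeff_qpInf _)]
        ring
  rw [h2] at h1
  refine hasSum_of_eq h1 (fun n ↦ ?_) rfl
  rw [crankTail_mul_recip]
  ring

/-- The difference of the crank and rank series as a telescoping sum. -/
theorem hasSum_crankTail_sub (z w : R⟦X⟧) :
    HasSum (fun n ↦ (crankTail z w n - crankTail z w (n + 1)) * recip (qpInf (X ^ (n + 1))))
      (crankSeries z w - 1 - rankSeries z w) := by
  -- W runs from `crankSeries` at n = 0 to the limit 1. The defect q^{n+1} W n, which comes from
  -- 1/(q^{n+2})_∞ = (1 - q^{n+1})/(q^{n+1})_∞, sums to the rank series.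
  let W : ℕ → R⟦X⟧ := fun n ↦ crankTail z w n * recip (qpInf (X ^ n))
  have hW1 : ∀ n, X ^ n ∣ W n - 1 := fun n ↦
    X_pow_dvd_mul_sub_one (X_pow_dvd_crankTail_sub_one z w n)
      (by simpa using X_pow_dvd_recip_qpInf_sub_one (1 : R⟦X⟧) n)
  have hW0 : W 0 = crankSeries z w := by
    simp only [W]
    rw [crankTail_mul_recip, qp_zero, qbinomCoeff, qp_zero, qp_zero]
    have := mul_recip (f := (1 : R⟦X⟧)) (by simp)
    rw [one_mul] at this
    rw [this]
    ring
  have hterm : ∀ n, (crankTail z w n - crankTail z w (n + 1)) * recip (qpInf (X ^ (n + 1)))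
      = W n - W (n + 1) - X ^ (n + 1) * W n := fun n ↦ by
    have := crankTail_mul_recip_succ z w n
    simp only [W]
    linear_combination this
  have hpart : ∀ N, ∑ n ∈ range N,
      (crankTail z w n - crankTail z w (n + 1)) * recip (qpInf (X ^ (n + 1)))
      = W 0 - W N - ∑ n ∈ range N, X ^ (n + 1) * W n := fun N ↦ by
    rw [← sum_range_sub', ← sum_sub_distrib]
    exact sum_congr rfl fun n _ ↦ hterm n
  refine hasSum_of_tendsto (fun n ↦ ?_) ?_
  · refine Dvd.dvd.mul_right ?_ _
    rw [show crankTail z w n - crankTail z w (n + 1) =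
      (crankTail z w n - 1) - (crankTail z w (n + 1) - 1) by ring]
    exact dvd_sub (X_pow_dvd_crankTail_sub_one z w n)
      ((pow_dvd_pow X n.le_succ).trans (X_pow_dvd_crankTail_sub_one z w (n + 1)))
  · simp only [hpart, ← hW0]
    exact (tendsto_const_nhds.sub (tendsto_of_X_pow_dvd_sub hW1)).sub
      (hasSum_X_pow_mul_crankTail z w).tendsto_sum_nat

/-- Term n belongs to partitions without ones and with largest part n + 2. It is 1 - q times the
q-binomial series with a = 0, whose first two terms are removed. -/
theorem hasSum_crank_without_ones (z : R⟦X⟧) :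
    HasSum (fun n ↦ recip (qp X (n + 1)) * (z * X) ^ (n + 2))
      ((1 - X) * recip (qpInf z) - (1 - X) - z * X) := by
  have h := hasSum_qbinom 0 z
  rw [show (0 : R⟦X⟧) * z * X = 0 by ring, qpInf_zero, one_mul] at h
  have h1 := (hasSum_nat_add_iff' 2).2 (h.mul_left (1 - X))
  have e1 : (1 - X) * recip (qp (1 : R⟦X⟧) 1) = 1 := by
    rw [one_sub_X_mul_recip_qp, qp_zero, recip_one]
  refine hasSum_of_eq h1 (fun n ↦ ?_) ?_
  · rw [qbinomCoeff_zero_left, ← one_sub_X_mul_recip_qp]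
    ring
  · rw [sum_range_succ, sum_range_one, qbinomCoeff_zero_left, qbinomCoeff_zero_left, qp_zero,
      recip_one]
    linear_combination (z * X) * e1

/-- Term j belongs to partitions with j + 1 ones: parts from 2 to j + 1 have weight 1 and larger
parts weight z. The q-binomial theorem applies with a = z, t = w, and zw = 1 makes its numerator
(q²;q)_∞. -/
theorem hasSum_crank_with_ones {z w : R⟦X⟧} (hzw : z * w = 1) :
    HasSum (fun j ↦ recip (qp X j) * (w * X) ^ (j + 1) * recip (qpInf (z * X ^ (j + 1))))
      (crankSeries z w - (1 - X) * recip (qpInf z)) := by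
  have h := (hasSum_nat_add_iff' 1).2
    ((hasSum_qbinom z w).mul_left ((1 - X) * recip (qpInf z)))
  have e0 := qpInf_X_pow (R := R) 0
  simp only [pow_zero, zero_add, pow_one] at e0
  refine hasSum_of_eq h (fun j ↦ ?_) ?_
  · have ez : recip (qpInf z) = recip (qp z (j + 1)) * recip (qpInf (z * X ^ (j + 1))) := by
      rw [← recip_mul (constantCoeff_qp _ _) (constantCoeff_qpInf _), ← qpInf_eq_qp_mul]
    rw [ez, qbinomCoeff, ← one_sub_X_mul_recip_qp]
    linear_combination (-((1 - X) * recip (qp 1 (j + 1)) * (w * X) ^ (j + 1) *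
      recip (qpInf (z * X ^ (j + 1))))) * mul_recip (constantCoeff_qp z (j + 1))
  · rw [sum_range_one, qbinomCoeff, qp_zero, qp_zero, recip_one, hzw, one_mul, crankSeries, e0]
    ring

end RankCrank

/-! ### Geometric series and their derivatives. -/

section Geometric

variable {R : Type*} [CommRing R] [TopologicalSpace R] [T2Space R]

theorem hasSum_geometric {y : R⟦X⟧} (hy : X ∣ y) :
    HasSum (fun j : ℕ ↦ y ^ (j + 1)) (y * recip (1 - y)) := by
  have hr := mul_recip (constantCoeff_one_sub (X_dvd_iff.1 hy))
  refine hasSum_of_X_pow_dvd_sub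
    (fun n ↦ (pow_dvd_pow_of_dvd hy n).trans (pow_dvd_pow y n.le_succ)) fun N ↦ ?_
  have h : ∀ N, ∑ j ∈ range N, y ^ (j + 1) - y * recip (1 - y) = -(y ^ (N + 1) * recip (1 - y)) := by
    intro N
    induction N with
    | zero => simp
    | succ N ih =>
      rw [sum_range_succ]
      linear_combination ih - y ^ (N + 1) * hr
  rw [h]
  exact (((pow_dvd_pow_of_dvd hy N).trans (pow_dvd_pow y N.le_succ)).mul_right _).neg_right

theorem hasSum_mul_geometric {y : R⟦X⟧} (hy : X ∣ y) :
    HasSum (fun j : ℕ ↦ ((j + 1 : ℕ) : R⟦X⟧) * y ^ (j + 1)) (y * recip ((1 - y) ^ 2)) := by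
  have h0 := constantCoeff_one_sub (X_dvd_iff.1 hy)
  have hr := mul_recip (f := (1 - y) ^ 2) (by rw [map_pow, h0, one_pow])
  refine hasSum_of_X_pow_dvd_sub
    (fun n ↦ ((pow_dvd_pow_of_dvd hy n).trans (pow_dvd_pow y n.le_succ)).mul_left _) fun N ↦ ?_
  have h : ∀ N : ℕ, ∑ j ∈ range N, ((j + 1 : ℕ) : R⟦X⟧) * y ^ (j + 1) - y * recip ((1 - y) ^ 2) =
      y ^ (N + 1) * (((N : R⟦X⟧) * y - ((N : R⟦X⟧) + 1)) * recip ((1 - y) ^ 2)) := by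
    intro N
    induction N with
    | zero => simp
    | succ N ih =>
      rw [sum_range_succ]
      push_cast at ih ⊢
      linear_combination ih - (N + 1) * y ^ (N + 1) * hr
  rw [h]
  exact ((pow_dvd_pow_of_dvd hy N).trans (pow_dvd_pow y N.le_succ)).mul_right _

end Geometric

/-! ### Partition generating functions with one distinguished part size. -/

section PartitionSeries

variable {R : Type*} [CommRing R]

/-- The weight `h (count of m) * ∏ g a`, the product over the parts `a ≠ m`. -/
def partWeight (m : ℕ) (h g : ℕ → R) (s : Multiset ℕ) : R :=
  h (s.count m) * ((s.filter (· ≠ m)).map g).prod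

/-- In a product over the sizes that occur, an absent size counts as 1. A weight that vanishes when
m is absent is therefore a difference: all partitions minus those that avoid m. -/
theorem partWeight_eq_sub (m : ℕ) {h : ℕ → R} (h0 : h 0 = 0) (g : ℕ → R) (s : Multiset ℕ) :
    partWeight m h g s = s.toFinsupp.prod (fun i c ↦ if i = m then h c else g i ^ c)
      - s.toFinsupp.prod (fun i c ↦ if i = m then 0 else g i ^ c) := by
  simp only [Finsupp.prod, Multiset.toFinsupp_support, Multiset.toFinsupp_apply]
  by_cases hm : m ∈ s
  · have hm' : m ∈ s.toFinset := Multiset.mem_toFinset.2 hm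
    have hfilter : (s.filter (· ≠ m)).toFinset = s.toFinset.erase m := by
      ext a
      simp [and_comm]
    rw [← mul_prod_erase _ _ hm', ← mul_prod_erase _ (fun i ↦ if i = m then 0 else _) hm']
    simp only [if_true, zero_mul, sub_zero]
    rw [partWeight, prod_multiset_map_count, hfilter]
    congr 1
    refine prod_congr rfl fun a ha ↦ ?_
    have ha := ne_of_mem_erase ha
    rw [if_neg ha, Multiset.count_filter_of_pos (p := (· ≠ m)) ha]
  · rw [partWeight, Multiset.count_eq_zero.2 hm, h0, zero_mul, eq_comm, sub_eq_zero]
    refine prod_congr rfl fun a ha ↦ ?_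
    have : a ≠ m := fun h ↦ hm (h ▸ Multiset.mem_toFinset.1 ha)
    rw [if_neg this, if_neg this]

variable [TopologicalSpace R] [IsTopologicalRing R]

theorem tendsto_prod_qpInf {φ : ℕ → R⟦X⟧} {c : R⟦X⟧} {n : ℕ}
    (h : ∀ i, n ≤ i → φ i = 1 - c * X ^ (i + 1)) :
    Tendsto (fun N ↦ ∏ i ∈ range N, φ i) atTop (𝓝 ((∏ i ∈ range n, φ i) * qpInf (c * X ^ n))) := by
  have h1 := (tendsto_qp (c * X ^ n)).const_mul (∏ i ∈ range n, φ i)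
  refine (tendsto_add_atTop_iff_nat n).1 (h1.congr fun k ↦ ?_)
  rw [add_comm, prod_range_add]
  congr 1
  refine prod_congr rfl fun i _ ↦ ?_
  rw [h _ (Nat.le_add_right _ _)]
  ring

/-- The generating function of a weight on partitions is the sum over the fibres of a statistic. -/
theorem hasSum_fiber (cls : Multiset ℕ → ℕ) (wt : Multiset ℕ → R) :
    HasSum (fun n ↦ PowerSeries.mk fun d ↦
        ∑ p : d.Partition, if cls p.parts = n then wt p.parts else 0)
      (PowerSeries.mk fun d ↦ ∑ p : d.Partition, wt p.parts) := by
  rw [WithPiTopology.hasSum_iff_hasSum_coeff]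
  intro d
  simp only [coeff_mk]
  refine hasSum_sum fun p _ ↦ ?_
  have := hasSum_ite_eq (cls p.parts) (wt p.parts)
  simpa only [eq_comm] using this

variable [T2Space R]

/-- The generating function of partitions weighted by `partWeight`. -/
theorem partWeight_series_mul (m : ℕ) {h g : ℕ → R} (h0 : h 0 = 0) {H Q : R⟦X⟧}
    (hH : HasSum (fun j ↦ C (h (j + 1)) * X ^ ((m + 1) * (j + 1))) H)
    (hQ : Tendsto (fun N ↦ ∏ i ∈ range N, if i = m then 1 else 1 - C (g (i + 1)) * X ^ (i + 1))
      atTop (𝓝 Q)) :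
    PowerSeries.mk (fun d ↦ ∑ p : d.Partition, partWeight (m + 1) h g p.parts) * Q = H := by
  let f : ℕ → ℕ → R := fun i c ↦ if i = m + 1 then h c else g i ^ c
  let f₀ : ℕ → ℕ → R := fun i c ↦ if i = m + 1 then 0 else g i ^ c
  have hF := (Nat.Partition.hasProd_genFun f).tendsto_prod_nat
  have hF₀ := (Nat.Partition.hasProd_genFun f₀).tendsto_prod_nat
  have hdiff : PowerSeries.mk (fun d ↦ ∑ p : d.Partition, partWeight (m + 1) h g p.parts)
      = Nat.Partition.genFun f - Nat.Partition.genFun f₀ := by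
    ext d
    simp only [coeff_mk, map_sub, Nat.Partition.coeff_genFun, ← sum_sub_distrib]
    exact sum_congr rfl fun p _ ↦ partWeight_eq_sub (m + 1) h0 g p.parts
  have hfac : ∀ i, i ≠ m → (1 - C (g (i + 1)) * X ^ (i + 1)) *
      (1 + ∑' j, f₀ (i + 1) (j + 1) • (X : R⟦X⟧) ^ ((i + 1) * (j + 1))) = 1 := by
    intro i hi
    have hX : (X : R⟦X⟧) ∣ C (g (i + 1)) * X ^ (i + 1) :=
      Dvd.intro_left (C (g (i + 1)) * X ^ i) (by ring)
    have h1 : (∑' j, f₀ (i + 1) (j + 1) • (X : R⟦X⟧) ^ ((i + 1) * (j + 1))) =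
        C (g (i + 1)) * X ^ (i + 1) * recip (1 - C (g (i + 1)) * X ^ (i + 1)) := by
      rw [← (hasSum_geometric hX).tsum_eq]
      refine tsum_congr fun j ↦ ?_
      simp only [f₀, add_left_inj, if_neg hi, smul_eq_C_mul, map_pow, mul_pow, ← pow_mul]
    rw [h1]
    linear_combination C (g (i + 1)) * X ^ (i + 1) *
      mul_recip (constantCoeff_one_sub (X_dvd_iff.1 hX))
  have hfm : (∑' j, f (m + 1) (j + 1) • (X : R⟦X⟧) ^ ((m + 1) * (j + 1))) = H := by
    rw [← hH.tsum_eq]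
    refine tsum_congr fun j ↦ ?_
    simp only [f, if_true, smul_eq_C_mul]
  -- Each size other than m + 1 contributes mutually inverse factors; size m + 1 contributes 1 to
  -- both.
  have hone : Nat.Partition.genFun f₀ * Q = 1 := by
    refine tendsto_nhds_unique (hF₀.mul hQ) (tendsto_const_nhds.congr fun N ↦ ?_)
    rw [← prod_mul_distrib, eq_comm]
    refine prod_eq_one fun i _ ↦ ?_
    by_cases hi : i = m
    · simp [f₀, hi]
    · rw [if_neg hi, mul_comm]
      exact hfac i hi
  -- The two Euler products differ only in the factor of size m + 1.
  have hmul : Nat.Partition.genFun f = (1 + H) * Nat.Partition.genFun f₀ := by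
    refine tendsto_nhds_unique hF ((hF₀.const_mul (1 + H)).congr' ?_)
    filter_upwards [eventually_gt_atTop m] with N hN
    rw [← mul_prod_erase _ _ (mem_range.2 hN), ← mul_prod_erase (range N) (fun i ↦ 1 + ∑' j,
      f (i + 1) (j + 1) • (X : R⟦X⟧) ^ ((i + 1) * (j + 1))) (mem_range.2 hN), hfm]
    have : (∑' j, f₀ (m + 1) (j + 1) • (X : R⟦X⟧) ^ ((m + 1) * (j + 1))) = 0 := by simp [f₀]
    rw [this, add_zero, one_mul]
    congr 1
    refine prod_congr rfl fun i hi ↦ ?_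
    have := ne_of_mem_erase hi
    simp [f, f₀, this]
  rw [hdiff, hmul]
  linear_combination H * hone

end PartitionSeries

/-! ### Extremal parts, phrased as conditions on the non-distinguished parts. -/

section MultisetProducts

variable {R : Type*} [CommRing R]

theorem prod_map_ite_zero (s : Multiset ℕ) (q : ℕ → Prop) [DecidablePred q] (c : R)
    [Decidable (∀ a ∈ s, q a)] :
    (s.map fun a ↦ if q a then c else 0).prod = if ∀ a ∈ s, q a then c ^ s.card else 0 := by
  split_ifs with h
  · rw [Multiset.map_congr rfl (g := fun _ ↦ c) fun a ha ↦ if_pos (h a ha), Multiset.map_const',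
      Multiset.prod_replicate]
  · push Not at h
    obtain ⟨a, ha, hq⟩ := h
    exact Multiset.prod_eq_zero (Multiset.mem_map.2 ⟨a, ha, if_neg hq⟩)

theorem prod_map_ite_one (s : Multiset ℕ) (q : ℕ → Prop) [DecidablePred q] (c : R) :
    (s.map fun a ↦ if q a then 1 else c).prod = c ^ (s.filter fun a ↦ ¬ q a).card := by
  induction s using Multiset.induction with
  | empty => simp
  | cons a s ih =>
    by_cases ha : q a
    · simp [ha, ih]
    · simp [ha, ih, pow_succ']

theorem count_add_card_filter_ne (s : Multiset ℕ) (m : ℕ) :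
    s.count m + (s.filter (· ≠ m)).card = s.card := by
  induction s using Multiset.induction with
  | empty => simp
  | cons a s ih =>
    by_cases ha : a = m
    · subst ha
      simp [← ih]
      ring
    · simp [ha, ← ih, Multiset.count_cons_of_ne (Ne.symm ha)]
      ring

theorem sup_eq_succ_iff (s : Multiset ℕ) (n : ℕ) :
    s.sup = n + 1 ↔ n + 1 ∈ s ∧ ∀ a ∈ s.filter (· ≠ n + 1), a < n + 1 := by
  simp only [Multiset.mem_filter]
  constructor
  · intro h
    have hle : ∀ a ∈ s, a ≤ n + 1 := fun a ha ↦ h ▸ Multiset.le_sup ha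
    refine ⟨?_, fun a ha ↦ lt_of_le_of_ne (hle a ha.1) ha.2⟩
    by_contra hn
    have : s.sup ≤ n := Multiset.sup_le.2 fun a ha ↦
      Nat.lt_succ_iff.1 (lt_of_le_of_ne (hle a ha) fun e : a = n + 1 ↦ hn (e ▸ ha))
    omega
  · rintro ⟨h1, h2⟩
    refine le_antisymm (Multiset.sup_le.2 fun a ha ↦ ?_) (Multiset.le_sup h1)
    by_cases e : a = n + 1
    · exact e.le
    · exact (h2 a ⟨ha, e⟩).le

theorem sInf_eq_succ_iff (s : Multiset ℕ) (n : ℕ) :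
    sInf {a | a ∈ s} = n + 1 ↔ n + 1 ∈ s ∧ ∀ a ∈ s.filter (· ≠ n + 1), n + 1 < a := by
  simp only [Multiset.mem_filter]
  constructor
  · intro h
    -- Since `sInf ∅ = 0`, the value n + 1 forces a part to exist.
    have hne : {a | a ∈ s}.Nonempty := by
      by_contra he
      rw [Set.not_nonempty_iff_eq_empty] at he
      rw [he, Nat.sInf_empty] at h
      omega
    have hmem := Nat.sInf_mem hne
    rw [h] at hmem
    refine ⟨hmem, fun a ha ↦ lt_of_le_of_ne (h ▸ Nat.sInf_le ha.1) (Ne.symm ha.2)⟩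
  · rintro ⟨h1, h2⟩
    refine le_antisymm (Nat.sInf_le h1) (le_csInf ⟨_, h1⟩ fun a ha ↦ ?_)
    by_cases e : a = n + 1
    · exact e.ge
    · exact (h2 a ⟨ha, e⟩).le

end MultisetProducts

/-! ### Series of the classes of partitions with fixed statistic; `E m` plays the role of z^m. -/

section Classes

variable {R : Type*} [CommRing R] {E : ℤ → R}

theorem exp_natCast_mul (h0 : E 0 = 1) (hadd : ∀ a b, E (a + b) = E a * E b) (e : ℤ) (n : ℕ) :
    E e ^ n = E (n * e) := by
  induction n with
  | zero => simp [h0]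
  | succ n ih => rw [pow_succ, ih, ← hadd]; congr 1; push_cast; ring

/-- The largest part is distinguished: its presence gives z^{n+1}, every part gives z⁻¹, and larger
parts are killed by weight 0. -/
theorem partWeight_rank (h0 : E 0 = 1) (hadd : ∀ a b, E (a + b) = E a * E b) (n : ℕ)
    (s : Multiset ℕ) :
    partWeight (n + 1) (fun c ↦ if c = 0 then 0 else E (n + 1) * E (-1) ^ c)
      (fun a ↦ if a < n + 1 then E (-1) else 0) s
      = if s.sup = n + 1 then E (s.sup - s.card) else 0 := by
  classical
  rw [partWeight, prod_map_ite_zero]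
  by_cases h : s.sup = n + 1
  · have h' := (sup_eq_succ_iff s n).1 h
    rw [if_pos h'.2, if_pos h, if_neg (Multiset.count_ne_zero.2 h'.1), mul_assoc, ← pow_add,
      count_add_card_filter_ne, exp_natCast_mul h0 hadd, ← hadd, h]
    congr 1
    push_cast
    ring
  · rw [if_neg h]
    by_cases hm : n + 1 ∈ s
    · rw [if_neg (fun h2 ↦ h ((sup_eq_succ_iff s n).2 ⟨hm, h2⟩)), mul_zero]
    · rw [Multiset.count_eq_zero.2 hm, if_pos rfl, zero_mul]

theorem partWeight_crank_without_ones (n : ℕ) {s : Multiset ℕ} (hs : ∀ a ∈ s, 0 < a) :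
    partWeight (n + 2) (fun c ↦ if c = 0 then 0 else E (n + 2))
      (fun a ↦ if 2 ≤ a ∧ a < n + 2 then 1 else 0) s
      = if s.sup = n + 2 then (if s.count 1 = 0 then E s.sup else 0) else 0 := by
  classical
  rw [partWeight, prod_map_ite_zero, one_pow]
  by_cases h : s.sup = n + 2
  · have h' := (sup_eq_succ_iff s (n + 1)).1 h
    rw [if_pos h, if_neg (Multiset.count_ne_zero.2 h'.1), h]
    by_cases h1 : s.count 1 = 0
    · rw [if_pos h1, if_pos, mul_one]
      · push_cast
        rfl
      · refine fun a ha ↦ ⟨?_, h'.2 a ha⟩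
        have ha' := (Multiset.mem_filter.1 ha).1
        have := hs a ha'
        have : a ≠ 1 := fun e ↦ Multiset.count_eq_zero.1 h1 (e ▸ ha')
        omega
    · rw [if_neg h1, if_neg, mul_zero]
      intro h2
      have := h2 1 (Multiset.mem_filter.2 ⟨Multiset.count_ne_zero.1 h1, by omega⟩)
      omega
  · rw [if_neg h]
    by_cases hm : n + 2 ∈ s
    · have : ¬ ∀ a ∈ s.filter (· ≠ n + 2), 2 ≤ a ∧ a < n + 2 := fun h2 ↦
        h ((sup_eq_succ_iff s (n + 1)).2 ⟨hm, fun a ha ↦ (h2 a ha).2⟩)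
      rw [if_neg this, mul_zero]
    · rw [Multiset.count_eq_zero.2 hm, if_pos rfl, zero_mul]

/-- The distinguished size is 1, since the number of ones decides which other parts the crank
counts. -/
theorem partWeight_crank_with_ones (h0 : E 0 = 1) (hadd : ∀ a b, E (a + b) = E a * E b) (j : ℕ)
    (s : Multiset ℕ) :
    partWeight 1 (fun c ↦ if c = j + 1 then E (-1) ^ (j + 1) else 0)
      (fun a ↦ if a ≤ j + 1 then 1 else E 1) s
      = if s.count 1 = j + 1 then
          (if s.count 1 = 0 then 0 else E ((s.filter (s.count 1 < ·)).card - s.count 1)) else 0 := by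
  rw [partWeight, prod_map_ite_one, Multiset.filter_filter]
  by_cases h : s.count 1 = j + 1
  · have hf : s.filter (fun a ↦ ¬ a ≤ j + 1 ∧ a ≠ 1) = s.filter (j + 1 < ·) :=
      Multiset.filter_congr fun a _ ↦ by omega
    rw [if_pos h, if_pos h, h, if_neg (Nat.succ_ne_zero j), hf, exp_natCast_mul h0 hadd,
      exp_natCast_mul h0 hadd, ← hadd]
    congr 1
    push_cast
    ring
  · rw [if_neg h, if_neg h, zero_mul]

theorem partWeight_spt (n : ℕ) (s : Multiset ℕ) :
    partWeight (n + 1) (fun c ↦ (c : R)) (fun a ↦ if n + 1 < a then 1 else 0) s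
      = if sInf {a | a ∈ s} = n + 1 then (s.count (sInf {a | a ∈ s}) : R) else 0 := by
  classical
  rw [partWeight, prod_map_ite_zero, one_pow]
  by_cases h : sInf {a | a ∈ s} = n + 1
  · rw [if_pos ((sInf_eq_succ_iff s n).1 h).2, if_pos h, h, mul_one]
  · rw [if_neg h]
    by_cases hm : n + 1 ∈ s
    · rw [if_neg (fun h2 ↦ h ((sInf_eq_succ_iff s n).2 ⟨hm, h2⟩)), mul_zero]
    · rw [Multiset.count_eq_zero.2 hm, Nat.cast_zero, zero_mul]

theorem partWeight_count (n : ℕ) (s : Multiset ℕ) :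
    partWeight (n + 1) (fun c ↦ ((n + 1 : ℕ) : R) * c) (fun _ ↦ 1) s
      = ((n + 1 : ℕ) : R) * s.count (n + 1) := by
  simp [partWeight]

variable [TopologicalSpace R] [T2Space R] [IsTopologicalRing R]

theorem rank_class_series (h0 : E 0 = 1) (hadd : ∀ a b, E (a + b) = E a * E b) (n : ℕ) :
    PowerSeries.mk (fun d ↦ ∑ p : d.Partition,
      if p.parts.sup = n + 1 then E (p.parts.sup - p.parts.card) else 0)
      = C (E 1) ^ n * X ^ (n + 1) * recip (qp (C (E (-1))) (n + 1)) := by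
  simp only [← partWeight_rank h0 hadd n]
  set w : R⟦X⟧ := C (E (-1)) with hw
  have hX : (X : R⟦X⟧) ∣ w * X ^ (n + 1) := Dvd.intro_left (w * X ^ n) (by ring)
  have key := partWeight_series_mul n (h := fun c ↦ if c = 0 then 0 else E (n + 1) * E (-1) ^ c)
    (g := fun a ↦ if a < n + 1 then E (-1) else 0) (if_pos rfl)
    (H := C (E (n + 1)) * (w * X ^ (n + 1) * recip (1 - w * X ^ (n + 1)))) (Q := qp w n) ?_ ?_
  · rw [eq_mul_recip (constantCoeff_qp _ _) key, qp_succ,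
      recip_mul (constantCoeff_qp _ _) (constantCoeff_one_sub_mul_X_pow _ _)]
    -- The first copy of the largest part carries z^{n+1} z⁻¹ = z^n.
    have : C (E (n + 1)) * w = C (E 1) ^ n := by
      rw [hw, ← map_mul, ← map_pow, ← hadd, exp_natCast_mul h0 hadd]
      congr 2
      ring
    linear_combination (X ^ (n + 1) * recip (1 - w * X ^ (n + 1)) * recip (qp w n)) * this
  · refine hasSum_of_eq ((hasSum_geometric hX).mul_left (C (E (n + 1)))) (fun j ↦ ?_) rfl
    rw [if_neg (Nat.succ_ne_zero j), map_mul, map_pow, mul_pow, ← pow_mul, mul_assoc]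
  -- With c = 0 all factors beyond the largest part are 1, so the infinite product is finite.
  · have := tendsto_prod_qpInf (n := n + 1) (c := 0) (φ := fun i ↦ if i = n then 1 else
      1 - C (if i + 1 < n + 1 then E (-1) else 0) * (X : R⟦X⟧) ^ (i + 1)) fun i hi ↦ ?_
    · rw [show (0 : R⟦X⟧) * X ^ (n + 1) = 0 by ring, qpInf_zero, mul_one, prod_range_succ,
        if_pos rfl, mul_one] at this
      convert this using 2
      refine prod_congr rfl fun i hi ↦ ?_
      have := mem_range.1 hi
      rw [if_neg this.ne, if_pos (by omega)]
    · rw [if_neg (by omega), if_neg (by omega), map_zero]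

theorem crank_without_ones_class_series (n : ℕ) :
    PowerSeries.mk (fun d ↦ ∑ p : d.Partition, if p.parts.sup = n + 2 then
        (if p.parts.count 1 = 0 then E p.parts.sup else 0) else 0)
      = C (E (n + 2)) * X ^ (n + 2) * recip (qp X (n + 1)) := by
  have hpt (d : ℕ) (p : d.Partition) :=
    partWeight_crank_without_ones (E := E) n (s := p.parts) (fun a ha ↦ p.parts_pos ha)
  simp only [← hpt]
  have hX : (X : R⟦X⟧) ∣ X ^ (n + 2) := Dvd.intro_left (X ^ (n + 1)) (by ring)
  have key := partWeight_series_mul (n + 1) (h := fun c ↦ if c = 0 then 0 else E (n + 2))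
    (g := fun a ↦ if 2 ≤ a ∧ a < n + 2 then 1 else 0) (if_pos rfl)
    (H := C (E (n + 2)) * (X ^ (n + 2) * recip (1 - X ^ (n + 2)))) (Q := qp X n) ?_ ?_
  · rw [eq_mul_recip (constantCoeff_qp _ _) key, qp_succ,
      recip_mul (constantCoeff_qp _ _) (constantCoeff_one_sub_mul_X_pow _ _),
      show (X : R⟦X⟧) * X ^ (n + 1) = X ^ (n + 2) by ring]
    ring
  · refine hasSum_of_eq ((hasSum_geometric hX).mul_left (C (E (n + 2)))) (fun j ↦ ?_) rfl
    rw [if_neg (Nat.succ_ne_zero j), ← pow_mul]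
  · have := tendsto_prod_qpInf (n := n + 2) (c := 0) (φ := fun i ↦ if i = n + 1 then 1 else
      1 - C (if 2 ≤ i + 1 ∧ i + 1 < n + 2 then 1 else 0) * (X : R⟦X⟧) ^ (i + 1)) fun i hi ↦ ?_
    · rw [show (0 : R⟦X⟧) * X ^ (n + 2) = 0 by ring, qpInf_zero, mul_one, prod_range_succ,
        if_pos rfl, mul_one, prod_range_succ', if_neg (by omega), if_neg (by omega), map_zero] at this
      convert this using 2
      rw [show (1 : R⟦X⟧) - 0 * X ^ (0 + 1) = 1 by ring, mul_one]
      refine prod_congr rfl fun i hi ↦ ?_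
      have := mem_range.1 hi
      rw [if_neg (by omega), if_pos (by omega), map_one]
      ring
    · rw [if_neg (by omega), if_neg (by omega), map_zero]

theorem crank_with_ones_class_series (h0 : E 0 = 1) (hadd : ∀ a b, E (a + b) = E a * E b)
    (j : ℕ) :
    PowerSeries.mk (fun d ↦ ∑ p : d.Partition, if p.parts.count 1 = j + 1 then
        (if p.parts.count 1 = 0 then 0 else
          E ((p.parts.filter (p.parts.count 1 < ·)).card - p.parts.count 1)) else 0)
      = recip (qp X j) * (C (E (-1)) * X) ^ (j + 1) * recip (qpInf (C (E 1) * X ^ (j + 1))) := by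
  simp only [← partWeight_crank_with_ones h0 hadd j]
  have key := partWeight_series_mul 0 (h := fun c ↦ if c = j + 1 then E (-1) ^ (j + 1) else 0)
    (g := fun a ↦ if a ≤ j + 1 then 1 else E 1) (if_neg (Nat.succ_ne_zero j).symm)
    (H := (C (E (-1)) * X) ^ (j + 1)) (Q := qp X j * qpInf (C (E 1) * X ^ (j + 1))) ?_ ?_
  · have hc : constantCoeff (qp X j * qpInf (C (E 1) * X ^ (j + 1))) = 1 := by simp
    rw [zero_add] at key
    rw [eq_mul_recip hc key, recip_mul (constantCoeff_qp _ _) (constantCoeff_qpInf _)]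
    ring
  · refine hasSum_of_eq (hasSum_ite_eq j ((C (E (-1)) * X) ^ (j + 1))) (fun i ↦ ?_) rfl
    by_cases h : i = j
    · rw [if_pos (by omega), if_pos h, h, map_pow, mul_pow]
      ring
    · rw [if_neg (by omega), if_neg h, map_zero]
      ring
  · have := tendsto_prod_qpInf (n := j + 1) (c := C (E 1)) (φ := fun i ↦ if i = 0 then 1 else
      1 - C (if i + 1 ≤ j + 1 then 1 else E 1) * (X : R⟦X⟧) ^ (i + 1)) fun i hi ↦ ?_
    · rw [prod_range_succ', if_pos rfl, mul_one] at this
      convert this using 3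
      refine prod_congr rfl fun i hi ↦ ?_
      have := mem_range.1 hi
      rw [if_neg (by omega), if_pos (by omega), map_one]
      ring
    · rw [if_neg (by omega), if_neg (by omega)]

theorem spt_class_series (n : ℕ) :
    PowerSeries.mk (fun d ↦ ∑ p : d.Partition, if sInf {a | a ∈ p.parts} = n + 1 then
        (p.parts.count (sInf {a | a ∈ p.parts}) : R) else 0)
      = X ^ (n + 1) * recip ((1 - X ^ (n + 1)) ^ 2) * recip (qpInf (X ^ (n + 1))) := by
  simp only [← partWeight_spt (R := R) n]
  have hX : (X : R⟦X⟧) ∣ X ^ (n + 1) := Dvd.intro_left (X ^ n) (by ring)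
  have key := partWeight_series_mul n (h := fun c ↦ (c : R))
    (g := fun a ↦ if n + 1 < a then 1 else 0) Nat.cast_zero
    (H := X ^ (n + 1) * recip ((1 - X ^ (n + 1)) ^ 2)) (Q := qpInf (X ^ (n + 1))) ?_ ?_
  · exact eq_mul_recip (constantCoeff_qpInf _) key
  · refine hasSum_of_eq (hasSum_mul_geometric hX) (fun j ↦ ?_) rfl
    rw [map_natCast, ← pow_mul]
  · have := tendsto_prod_qpInf (n := n + 1) (c := 1) (φ := fun i ↦ if i = n then 1 else
      1 - C (if n + 1 < i + 1 then 1 else 0) * (X : R⟦X⟧) ^ (i + 1)) fun i hi ↦ ?_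
    · rw [one_mul, prod_eq_one, one_mul] at this
      · exact this
      · intro i hi
        have := mem_range.1 hi
        split_ifs
        · rfl
        · omega
        · rw [map_zero]; ring
    · rw [if_neg (by omega), if_pos (by omega), map_one]

theorem count_series (n : ℕ) :
    PowerSeries.mk (fun d ↦ ∑ p : d.Partition, ((n + 1 : ℕ) : R) * p.parts.count (n + 1))
      = ((n + 1 : ℕ) : R⟦X⟧) * (X ^ (n + 1) * recip (1 - X ^ (n + 1))) * recip (qpInf 1) := by
  simp only [← partWeight_count n]
  have hX : (X : R⟦X⟧) ∣ X ^ (n + 1) := Dvd.intro_left (X ^ n) (by ring)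
  have key := partWeight_series_mul n (h := fun c ↦ ((n + 1 : ℕ) : R) * c)
    (g := fun _ ↦ 1) (by simp)
    (H := ((n + 1 : ℕ) : R⟦X⟧) * (X ^ (n + 1) * recip ((1 - X ^ (n + 1)) ^ 2)))
    (Q := qp 1 n * qpInf (X ^ (n + 1))) ?_ ?_
  · have e1 : qpInf (1 : R⟦X⟧) = (qp 1 n * qpInf (X ^ (n + 1))) * (1 - X ^ (n + 1)) := by
      rw [qpInf_eq_qp_mul 1 (n + 1), qp_succ, one_mul]
      ring
    have r := mul_recip (constantCoeff_one_sub_X_pow (R := R) n)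
    rw [pow_two, recip_mul (constantCoeff_one_sub_X_pow n) (constantCoeff_one_sub_X_pow n)] at key
    refine eq_mul_recip (constantCoeff_qpInf _) ?_
    rw [e1]
    linear_combination (1 - X ^ (n + 1)) * key +
      ((n + 1 : ℕ) : R⟦X⟧) * (X ^ (n + 1) * recip (1 - X ^ (n + 1))) * r
  · refine hasSum_of_eq ((hasSum_mul_geometric hX).mul_left ((n + 1 : ℕ) : R⟦X⟧)) (fun j ↦ ?_) rfl
    rw [map_mul, map_natCast, map_natCast, ← pow_mul, mul_assoc]
  · have := tendsto_prod_qpInf (n := n + 1) (c := 1) (φ := fun i ↦ if i = n then 1 else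
      1 - C 1 * (X : R⟦X⟧) ^ (i + 1)) fun i hi ↦ ?_
    · rw [one_mul, prod_range_succ, if_pos rfl, mul_one] at this
      convert this using 3
      refine prod_congr rfl fun i hi ↦ ?_
      have := mem_range.1 hi
      rw [if_neg (by omega), map_one]
    · rw [if_neg (by omega), map_one]

end Classes

/-! ### Rank and crank generating functions, summed over the classes. -/

section GeneratingFunctions

variable {R : Type*} [CommRing R] {E : ℤ → R}

theorem parts_eq_zero_of_sup {d : ℕ} (p : d.Partition) (h : p.parts.sup = 0) : p.parts = 0 :=
  Multiset.eq_zero_of_forall_notMem fun a ha ↦ by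
    have h1 := p.parts_pos ha
    have h2 : a ≤ p.parts.sup := Multiset.le_sup ha
    omega

theorem mk_sum_eq_one {wt : Multiset ℕ → R} (h0 : wt 0 = 1)
    (h : ∀ (d : ℕ) (p : d.Partition), p.parts ≠ 0 → wt p.parts = 0) :
    PowerSeries.mk (fun d ↦ ∑ p : d.Partition, wt p.parts) = 1 := by
  ext d
  rw [coeff_mk, coeff_one]
  split_ifs with hd
  · subst hd
    rw [Fintype.sum_unique, Nat.Partition.partition_zero_parts, h0]
  · refine sum_eq_zero fun p _ ↦ h d p fun hp ↦ hd ?_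
    rw [← p.parts_sum, hp, Multiset.sum_zero]

variable [TopologicalSpace R] [T2Space R] [IsTopologicalRing R]

theorem rank_series (h0 : E 0 = 1) (hadd : ∀ a b, E (a + b) = E a * E b) :
    PowerSeries.mk (fun d ↦ ∑ p : d.Partition, E (p.parts.sup - p.parts.card))
      = 1 + rankSeries (C (E 1)) (C (E (-1))) := by
  have h := (hasSum_nat_add_iff' 1).2
    (hasSum_fiber Multiset.sup fun s : Multiset ℕ ↦ E (s.sup - s.card))
  simp only [rank_class_series h0 hadd, sum_range_one] at h
  have h1 := h.unique (hasSum_rankSeries _ _)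
  rw [mk_sum_eq_one (wt := fun s ↦ if s.sup = 0 then E (s.sup - s.card) else 0)
    (by simp [h0]) fun d p hp ↦ if_neg fun hs ↦ hp (parts_eq_zero_of_sup p hs)] at h1
  linear_combination h1

/-- The empty partition supplies 1, and no partition without ones has largest part 1. -/
theorem crank_without_ones_series (h0 : E 0 = 1) (hadd : ∀ a b, E (a + b) = E a * E b) :
    PowerSeries.mk (fun d ↦ ∑ p : d.Partition,
      if p.parts.count 1 = 0 then E p.parts.sup else 0)
      = (1 - X) * recip (qpInf (C (E 1))) + X - C (E 1) * X := by
  have h := (hasSum_nat_add_iff' 2).2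
    (hasSum_fiber Multiset.sup fun s : Multiset ℕ ↦ if s.count 1 = 0 then E s.sup else 0)
  simp only [crank_without_ones_class_series, sum_range_succ, sum_range_zero, zero_add] at h
  have h1 := h.unique (hasSum_of_eq (hasSum_crank_without_ones (C (E 1))) (fun n ↦ ?_) rfl)
  · rw [mk_sum_eq_one (wt := fun s ↦ if s.sup = 0 then if s.count 1 = 0 then E s.sup else 0 else 0)
      (by simp [h0]) fun d p hp ↦ if_neg fun hs ↦ hp (parts_eq_zero_of_sup p hs)] at h1
    have hz : PowerSeries.mk (fun d ↦ ∑ p : d.Partition, if p.parts.sup = 1 then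
        if p.parts.count 1 = 0 then E p.parts.sup else 0 else 0) = 0 := by
      ext d
      rw [coeff_mk, map_zero]
      refine sum_eq_zero fun p _ ↦ ?_
      split_ifs with hs hc
      · exact absurd ((sup_eq_succ_iff p.parts 0).1 hs).1 (Multiset.count_eq_zero.1 hc)
      · rfl
      · rfl
    rw [hz] at h1
    linear_combination h1
  · rw [mul_pow, ← map_pow, exp_natCast_mul h0 hadd]
    push_cast
    rw [mul_one]
    ring

theorem crank_with_ones_series (h0 : E 0 = 1) (hadd : ∀ a b, E (a + b) = E a * E b) :
    PowerSeries.mk (fun d ↦ ∑ p : d.Partition, if p.parts.count 1 = 0 then 0 else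
      E ((p.parts.filter (p.parts.count 1 < ·)).card - p.parts.count 1))
      = crankSeries (C (E 1)) (C (E (-1))) - (1 - X) * recip (qpInf (C (E 1))) := by
  have h := (hasSum_nat_add_iff' 1).2
    (hasSum_fiber (Multiset.count 1) fun s : Multiset ℕ ↦ if s.count 1 = 0 then 0 else
      E ((s.filter (s.count 1 < ·)).card - s.count 1))
  simp only [crank_with_ones_class_series h0 hadd, sum_range_one] at h
  have hzw : (C (E 1) * C (E (-1)) : R⟦X⟧) = 1 := by
    rw [← map_mul, ← hadd, add_neg_cancel, h0, map_one]
  have h1 := h.unique (hasSum_crank_with_ones hzw)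
  have hz : PowerSeries.mk (fun d ↦ ∑ p : d.Partition, if p.parts.count 1 = 0 then
      if p.parts.count 1 = 0 then 0 else
      E ((p.parts.filter (p.parts.count 1 < ·)).card - p.parts.count 1) else 0) = 0 := by
    ext d
    rw [coeff_mk, map_zero]
    refine sum_eq_zero fun p _ ↦ ?_
    split_ifs <;> rfl
  rw [hz, sub_zero] at h1
  exact h1

/-- The correction is confined to q¹: the product has coefficient z - 1 + z⁻¹ there, while the
partition of 1 has crank -1. -/
theorem crank_series (h0 : E 0 = 1) (hadd : ∀ a b, E (a + b) = E a * E b) :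
    PowerSeries.mk (fun d ↦ ∑ p : d.Partition, E (crank p))
      = crankSeries (C (E 1)) (C (E (-1))) + X - C (E 1) * X := by
  have h1 := crank_without_ones_series h0 hadd
  have h2 := crank_with_ones_series h0 hadd
  have h3 : PowerSeries.mk (fun d ↦ ∑ p : d.Partition, E (crank p)) =
      PowerSeries.mk (fun d ↦ ∑ p : d.Partition,
        if p.parts.count 1 = 0 then E p.parts.sup else 0) +
      PowerSeries.mk (fun d ↦ ∑ p : d.Partition, if p.parts.count 1 = 0 then 0 else
        E ((p.parts.filter (p.parts.count 1 < ·)).card - p.parts.count 1)) := by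
    ext d
    simp only [map_add, coeff_mk, ← sum_add_distrib]
    refine sum_congr rfl fun p _ ↦ ?_
    unfold crank
    split_ifs <;> simp
  rw [h3]
  linear_combination h1 + h2

end GeneratingFunctions

/-! ### Moments as sums over partitions. -/

section Moments

theorem card_parts_le {n : ℕ} (p : n.Partition) : p.parts.card ≤ n := by
  have h := Multiset.card_nsmul_le_sum (s := p.parts) (a := 1) fun a ha ↦ p.parts_pos ha
  rwa [p.parts_sum, smul_eq_mul, mul_one] at h

theorem sup_parts_le {n : ℕ} (p : n.Partition) : p.parts.sup ≤ n :=
  Multiset.sup_le.2 fun _ ha ↦ Nat.Partition.le_of_mem_parts ha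

theorem rank_mem_Icc {n : ℕ} (p : n.Partition) : rank p ∈ Icc (-(n : ℤ)) n := by
  have h1 := card_parts_le p
  have h2 := sup_parts_le p
  rw [mem_Icc, rank]
  omega

theorem crank_mem_Icc {n : ℕ} (p : n.Partition) : crank p ∈ Icc (-(n : ℤ)) n := by
  have h1 := card_parts_le p
  have h2 := sup_parts_le p
  have h3 := Multiset.count_le_card 1 p.parts
  have h4 := Multiset.card_le_card (Multiset.filter_le (p.parts.count 1 < ·) p.parts)
  rw [mem_Icc, crank]
  split_ifs <;> omega

theorem sum_mul_card_fiber {n : ℕ} {stat : n.Partition → ℤ}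
    (hstat : ∀ p, stat p ∈ Icc (-(n : ℤ)) n) (F : ℤ → ℤ) :
    ∑ m ∈ Icc (-(n : ℤ)) n, F m * (Fintype.card {p : n.Partition // stat p = m} : ℤ)
      = ∑ p : n.Partition, F (stat p) := by
  rw [← sum_fiberwise_of_maps_to (fun p _ ↦ hstat p)]
  refine sum_congr rfl fun m _ ↦ ?_
  rw [Fintype.card_subtype, sum_congr rfl (g := fun _ ↦ F m) fun p hp ↦ by
    rw [(mem_filter.1 hp).2], sum_const, nsmul_eq_mul, mul_comm]

theorem sum_mul_N (n : ℕ) (F : ℤ → ℤ) :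
    ∑ m ∈ Icc (-(n : ℤ)) n, F m * N m n = ∑ p : n.Partition, F (rank p) :=
  sum_mul_card_fiber rank_mem_Icc F

theorem crank_partition_one (p : Nat.Partition 1) : crank p = -1 := by
  simp [crank]

/-- At n = 1 the conventional values of M give F(-1) - F(0) + F(1), while the combinatorial crank
gives only F(-1). -/
theorem sum_mul_M (n : ℕ) (F : ℤ → ℤ) :
    ∑ m ∈ Icc (-(n : ℤ)) n, F m * M m n =
      ∑ p : n.Partition, F (crank p) + if n = 1 then F 1 - F 0 else 0 := by
  split_ifs with hn
  · subst hn
    rw [Fintype.sum_unique, crank_partition_one,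
      show Icc (-((1 : ℕ) : ℤ)) ((1 : ℕ) : ℤ) = {-1, 0, 1} by decide]
    simp [M]
    ring
  · rw [add_zero, ← sum_mul_card_fiber crank_mem_Icc]
    refine sum_congr rfl fun m _ ↦ ?_
    rw [M, if_neg hn]

theorem eta_eq (k n : ℕ) :
    eta (2 * k) n = ∑ p : n.Partition, Ring.choose (rank p + ((k : ℤ) - 1)) (2 * k) := by
  have h : (((2 * k : ℕ) : ℤ) - 1) / 2 = k - 1 := by omega
  rw [eta, h]
  exact sum_mul_N n fun m ↦ Ring.choose (m + ((k : ℤ) - 1)) (2 * k)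

theorem mu_eq (k n : ℕ) :
    mu (2 * k) n = ∑ p : n.Partition, Ring.choose (crank p + ((k : ℤ) - 1)) (2 * k) +
      if n = 1 then Ring.choose (1 + ((k : ℤ) - 1)) (2 * k) -
        Ring.choose (0 + ((k : ℤ) - 1)) (2 * k) else 0 := by
  have h : (((2 * k : ℕ) : ℤ) - 1) / 2 = k - 1 := by omega
  rw [mu, h]
  exact sum_mul_M n fun m ↦ Ring.choose (m + ((k : ℤ) - 1)) (2 * k)

end Moments

/-! ### Extraction of binomial moments at z = 1 + ε; in `ℤ⟦X⟧⟦X⟧` the inner variable is ε, the outer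
one q. -/

section Extraction

theorem binomialSeries_one : binomialSeries ℤ (1 : ℤ) = (1 + X : ℤ⟦X⟧) := by
  simpa using binomialSeries_nat (R := ℤ) (A := ℤ) 1

theorem binomialSeries_one_mul_neg_one :
    binomialSeries ℤ (1 : ℤ) * binomialSeries ℤ (-1 : ℤ) = (1 : ℤ⟦X⟧) := by
  rw [← binomialSeries_add, add_neg_cancel, binomialSeries_zero]

/-- The element `z - 2 + z⁻¹` for `z = 1 + ε`. -/
noncomputable def secondDiff : ℤ⟦X⟧ := binomialSeries ℤ (1 : ℤ) - 2 + binomialSeries ℤ (-1 : ℤ)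

/-- z(z - 2 + z⁻¹) = (z - 1)² = ε². Hence a factor `secondDiff` lowers the pair (r, e) to (r - 2, e
- 1). -/
theorem binomialSeries_mul_secondDiff (e : ℤ) :
    binomialSeries ℤ (e + 1) * secondDiff = X ^ 2 * binomialSeries ℤ e := by
  have h1 := binomialSeries_one
  have h2 := binomialSeries_one_mul_neg_one
  rw [binomialSeries_add, secondDiff, h1]
  rw [h1] at h2
  linear_combination binomialSeries ℤ e * h2

/-- Coefficientwise extraction of the coefficient of `ε ^ r` in `(1 + ε) ^ e * f`. -/
noncomputable def extract (r : ℕ) (e : ℤ) : ℤ⟦X⟧⟦X⟧ →+ ℤ⟦X⟧ where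
  toFun f := PowerSeries.mk fun d ↦ coeff r (binomialSeries ℤ e * coeff d f)
  map_zero' := by ext; simp
  map_add' f g := by ext; simp [mul_add]

theorem coeff_extract (r : ℕ) (e : ℤ) (f : ℤ⟦X⟧⟦X⟧) (d : ℕ) :
    coeff d (extract r e f) = coeff r (binomialSeries ℤ e * coeff d f) := by
  simp only [extract, AddMonoidHom.coe_mk, ZeroHom.coe_mk, coeff_mk]

theorem continuous_extract (r : ℕ) (e : ℤ) : Continuous (extract r e) := by
  rw [continuous_iff_continuousAt]
  intro f
  rw [ContinuousAt, WithPiTopology.tendsto_iff_coeff_tendsto]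
  intro d
  simp only [coeff_extract]
  exact ((WithPiTopology.continuous_coeff ℤ r).comp
    (continuous_const.mul (WithPiTopology.continuous_coeff ℤ⟦X⟧ d))).tendsto f

theorem X_pow_dvd_extract {r : ℕ} {e : ℤ} {f : ℤ⟦X⟧⟦X⟧} {N : ℕ} (h : X ^ N ∣ f) :
    X ^ N ∣ extract r e f := by
  rw [X_pow_dvd_iff] at h ⊢
  intro m hm
  rw [coeff_extract, h m hm, mul_zero, map_zero]

/-- `PowerSeries.map C g` is free of ε, so extraction is linear over such factors. -/
theorem extract_map_mul (r : ℕ) (e : ℤ) (g : ℤ⟦X⟧) (f : ℤ⟦X⟧⟦X⟧) :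
    extract r e (PowerSeries.map C g * f) = g * extract r e f := by
  ext d
  rw [coeff_extract, coeff_mul d, coeff_mul d, mul_sum, map_sum]
  refine sum_congr rfl fun p _ ↦ ?_
  rw [coeff_map, coeff_extract, mul_left_comm, coeff_C_mul]

theorem extract_secondDiff_mul (r : ℕ) (e : ℤ) (f : ℤ⟦X⟧⟦X⟧) :
    extract (r + 2) (e + 1) (C secondDiff * f) = extract r e f := by
  ext d
  rw [coeff_extract, coeff_extract, coeff_C_mul, ← mul_assoc, binomialSeries_mul_secondDiff,
    mul_assoc, coeff_X_pow_mul]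

theorem extract_secondDiff_mul_of_lt {r : ℕ} (hr : r < 2) (e : ℤ) (f : ℤ⟦X⟧⟦X⟧) :
    extract r e (C secondDiff * f) = 0 := by
  ext d
  have h := binomialSeries_mul_secondDiff (e - 1)
  rw [sub_add_cancel] at h
  rw [coeff_extract, coeff_C_mul, ← mul_assoc, h, mul_assoc, map_zero]
  exact X_pow_dvd_iff.1 (Dvd.intro _ rfl) r hr

theorem extract_one (r : ℕ) (e : ℤ) : extract r e 1 = C (Ring.choose e r) := by
  ext d
  rw [coeff_extract, coeff_one, coeff_C]
  split_ifs <;> simp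

end Extraction

/-! ### Moments of the tails and of crank minus rank. -/

section Tails

/-- `q^n / (1 - q^n)²`. -/
noncomputable def lambertTerm (n : ℕ) : ℤ⟦X⟧ := X ^ n * recip ((1 - X ^ n) ^ 2)

/-- The tail of the crank product at `z = 1 + ε`. -/
noncomputable def tail (n : ℕ) : ℤ⟦X⟧⟦X⟧ :=
  crankTail (C (binomialSeries ℤ (1 : ℤ))) (C (binomialSeries ℤ (-1 : ℤ))) n

theorem map_C_lambertTerm (n : ℕ) :
    PowerSeries.map (C : ℤ →+* ℤ⟦X⟧) (lambertTerm (n + 1)) =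
      X ^ (n + 1) * recip ((1 - X ^ (n + 1)) ^ 2) := by
  rw [lambertTerm, map_mul, map_recip _ (by simp)]
  simp

theorem continuous_map_C : Continuous (PowerSeries.map (C : ℤ →+* ℤ⟦X⟧)) := by
  rw [continuous_iff_continuousAt]
  intro f
  rw [ContinuousAt, WithPiTopology.tendsto_iff_coeff_tendsto]
  intro d
  simp only [coeff_map]
  exact ((continuous_of_discreteTopology (f := (C : ℤ →+* ℤ⟦X⟧))).comp
    (WithPiTopology.continuous_coeff ℤ d)).tendsto f

theorem map_C_qpInf (n : ℕ) :
    PowerSeries.map (C : ℤ →+* ℤ⟦X⟧) (qpInf (X ^ n)) = qpInf (X ^ n) := by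
  rw [qpInf, (multipliable_qpInf _).map_tprod _ continuous_map_C, qpInf]
  simp

theorem map_C_recip_qpInf (n : ℕ) :
    PowerSeries.map (C : ℤ →+* ℤ⟦X⟧) (recip (qpInf (X ^ n))) = recip (qpInf (X ^ n)) := by
  rw [map_recip _ (constantCoeff_qpInf _), map_C_qpInf]

theorem tail_sub_succ (n : ℕ) :
    tail n - tail (n + 1) =
      C secondDiff * (PowerSeries.map C (lambertTerm (n + 1)) * tail n) := by
  have hzw : (C (binomialSeries ℤ (1 : ℤ)) * C (binomialSeries ℤ (-1 : ℤ)) : ℤ⟦X⟧⟦X⟧) = 1 := by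
    rw [← map_mul, binomialSeries_one_mul_neg_one, map_one]
  rw [tail, tail, crankTail_sub_succ hzw, map_C_lambertTerm, secondDiff, map_add, map_sub,
    map_ofNat]
  ring

/-- Consecutive tails differ by a multiple of ε², so the extraction does not depend on n; the tails
tend to 1. -/
theorem extract_tail_of_lt {r : ℕ} (hr : r < 2) (e : ℤ) (n : ℕ) :
    extract r e (tail n) = C (Ring.choose e r) := by
  have hstep : ∀ N, extract r e (tail (n + N)) = extract r e (tail n) := by
    intro N
    induction N with
    | zero => rfl
    | succ N ih =>
      have := congrArg (extract r e) (tail_sub_succ (n + N))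
      rw [extract_secondDiff_mul_of_lt hr, map_sub, sub_eq_zero] at this
      rw [← ih, this, add_assoc]
  rw [← extract_one]
  refine eq_of_forall_X_pow_dvd_sub fun N ↦ ?_
  rw [← hstep N, ← map_sub]
  exact X_pow_dvd_extract ((pow_dvd_pow X (Nat.le_add_left N n)).trans
    (X_pow_dvd_crankTail_sub_one _ _ _))

/-- The complete homogeneous sum `∑ ∏ q^{n_i} / (1 - q^{n_i})²` over `n < n_1 ≤ ⋯ ≤ n_k`. -/
noncomputable def tailMoment (k n : ℕ) : ℤ⟦X⟧ := extract (2 * k) ((k : ℤ) - 1) (tail n)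

theorem tailMoment_zero (n : ℕ) : tailMoment 0 n = 1 := by
  rw [tailMoment, extract_tail_of_lt (by simp)]
  simp

theorem tailMoment_sub_succ (k n : ℕ) :
    tailMoment (k + 1) n - tailMoment (k + 1) (n + 1) = lambertTerm (n + 1) * tailMoment k n := by
  rw [tailMoment, tailMoment, ← map_sub, tail_sub_succ,
    show ((k + 1 : ℕ) : ℤ) - 1 = ((k : ℤ) - 1) + 1 by push_cast; ring,
    show 2 * (k + 1) = 2 * k + 2 by ring, extract_secondDiff_mul, extract_map_mul, tailMoment]

/-- The tail is 1 modulo q^n, and 1 extracts to binom(k, 2k + 2) = 0. -/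
theorem X_pow_dvd_tailMoment_succ (k n : ℕ) : X ^ n ∣ tailMoment (k + 1) n := by
  have h0 : extract (2 * (k + 1)) (((k + 1 : ℕ) : ℤ) - 1) 1 = 0 := by
    rw [extract_one, show ((k + 1 : ℕ) : ℤ) - 1 = (k : ℕ) by push_cast; ring, Ring.choose_natCast,
      Nat.choose_eq_zero_of_lt (by omega)]
    simp
  have := X_pow_dvd_extract (r := 2 * (k + 1)) (e := ((k + 1 : ℕ) : ℤ) - 1)
    (X_pow_dvd_crankTail_sub_one (C (binomialSeries ℤ (1 : ℤ))) (C (binomialSeries ℤ (-1 : ℤ))) n)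
  rwa [map_sub, h0, sub_zero] at this

theorem X_pow_dvd_lambertTerm (n : ℕ) : X ^ n ∣ lambertTerm n := Dvd.intro _ rfl

theorem hasSum_tailMoment_succ (k n : ℕ) :
    HasSum (fun i ↦ lambertTerm (n + i + 1) * tailMoment k (n + i)) (tailMoment (k + 1) n) := by
  refine hasSum_of_X_pow_dvd_sub (fun i ↦ ?_) fun N ↦ ?_
  · exact ((pow_dvd_pow X (by omega)).trans (X_pow_dvd_lambertTerm (n + i + 1))).mul_right _
  · have h : ∑ i ∈ range N, lambertTerm (n + i + 1) * tailMoment k (n + i)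
        = tailMoment (k + 1) n - tailMoment (k + 1) (n + N) := by
      refine Eq.trans ?_ (sum_range_sub' (fun i ↦ tailMoment (k + 1) (n + i)) N)
      exact sum_congr rfl fun i _ ↦ (tailMoment_sub_succ k (n + i)).symm
    rw [h, sub_sub_cancel_left]
    exact ((pow_dvd_pow X (by omega)).trans (X_pow_dvd_tailMoment_succ k (n + N))).neg_right

/-- The rank series at `z = 1 + ε`. -/
noncomputable def rankGF : ℤ⟦X⟧⟦X⟧ :=
  1 + rankSeries (C (binomialSeries ℤ (1 : ℤ))) (C (binomialSeries ℤ (-1 : ℤ)))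

/-- The crank series at `z = 1 + ε`. -/
noncomputable def crankGF : ℤ⟦X⟧⟦X⟧ :=
  crankSeries (C (binomialSeries ℤ (1 : ℤ))) (C (binomialSeries ℤ (-1 : ℤ)))

theorem hasSum_crankGF_sub_rankGF :
    HasSum (fun n ↦ C secondDiff *
      (PowerSeries.map C (lambertTerm (n + 1) * recip (qpInf (X ^ (n + 1)))) * tail n))
      (crankGF - rankGF) := by
  refine hasSum_of_eq (hasSum_crankTail_sub (C (binomialSeries ℤ (1 : ℤ)))
    (C (binomialSeries ℤ (-1 : ℤ)))) (fun n ↦ ?_) (by rw [crankGF, rankGF]; ring)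
  have := tail_sub_succ n
  rw [tail, tail] at this
  rw [this, map_mul, map_C_recip_qpInf, tail]
  ring

/-- The index n + 1 will be n_1; the explicit `secondDiff` uses up one of the k + 1 levels, and the
tail supplies the sum over the remaining k indices. -/
theorem hasSum_extract_crankGF_sub_rankGF (k : ℕ) :
    HasSum (fun n ↦ lambertTerm (n + 1) * recip (qpInf (X ^ (n + 1))) * tailMoment k n)
      (extract (2 * (k + 1)) (((k + 1 : ℕ) : ℤ) - 1) crankGF -
        extract (2 * (k + 1)) (((k + 1 : ℕ) : ℤ) - 1) rankGF) := by
  have h := hasSum_crankGF_sub_rankGF.map (extract (2 * (k + 1)) (((k + 1 : ℕ) : ℤ) - 1))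
    (continuous_extract _ _)
  refine hasSum_of_eq h (fun n ↦ ?_) (map_sub _ _ _).symm
  rw [Function.comp_apply, show ((k + 1 : ℕ) : ℤ) - 1 = ((k : ℤ) - 1) + 1 by push_cast; ring,
    show 2 * (k + 1) = 2 * k + 2 by ring, extract_secondDiff_mul, extract_map_mul, tailMoment]

theorem coeff_rankGF (d : ℕ) :
    coeff d rankGF = ∑ p : d.Partition, binomialSeries ℤ (rank p) := by
  rw [rankGF, ← rank_series (E := fun m : ℤ ↦ binomialSeries ℤ m) (binomialSeries_zero)
    binomialSeries_add, coeff_mk]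
  rfl

theorem coeff_crankGF (d : ℕ) :
    coeff d crankGF = ∑ p : d.Partition, binomialSeries ℤ (crank p) +
      if d = 1 then binomialSeries ℤ (1 : ℤ) - binomialSeries ℤ (0 : ℤ) else 0 := by
  have h := congrArg (coeff d) (crank_series (E := fun m : ℤ ↦ binomialSeries ℤ m)
    (binomialSeries_zero) binomialSeries_add)
  rw [coeff_mk, map_sub, map_add, coeff_C_mul, coeff_X] at h
  rw [h, crankGF, binomialSeries_zero]
  split_ifs <;> ring

theorem coeff_binomialSeries_mul (e m : ℤ) (r : ℕ) :
    coeff r (binomialSeries ℤ e * binomialSeries ℤ m) = Ring.choose (m + e) r := by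
  rw [← binomialSeries_add, binomialSeries_coeff, smul_eq_mul, mul_one, add_comm]

theorem coeff_extract_rankGF (r : ℕ) (e : ℤ) (d : ℕ) :
    coeff d (extract r e rankGF) = ∑ p : d.Partition, Ring.choose (rank p + e) r := by
  rw [coeff_extract, coeff_rankGF, mul_sum, map_sum]
  exact sum_congr rfl fun p _ ↦ coeff_binomialSeries_mul _ _ _

theorem coeff_extract_crankGF (r : ℕ) (e : ℤ) (d : ℕ) :
    coeff d (extract r e crankGF) = ∑ p : d.Partition, Ring.choose (crank p + e) r +
      if d = 1 then Ring.choose (1 + e) r - Ring.choose (0 + e) r else 0 := by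
  rw [coeff_extract, coeff_crankGF, mul_add, map_add, mul_sum, map_sum]
  congr 1
  · exact sum_congr rfl fun p _ ↦ coeff_binomialSeries_mul _ _ _
  · split_ifs
    · rw [mul_sub, map_sub, coeff_binomialSeries_mul, coeff_binomialSeries_mul]
    · simp

theorem coeff_extract_rankGF_eq_eta (k d : ℕ) :
    coeff d (extract (2 * k) ((k : ℤ) - 1) rankGF) = eta (2 * k) d := by
  rw [coeff_extract_rankGF, eta_eq]

theorem coeff_extract_crankGF_eq_mu (k d : ℕ) :
    coeff d (extract (2 * k) ((k : ℤ) - 1) crankGF) = mu (2 * k) d := by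
  rw [coeff_extract_crankGF, mu_eq]

end Tails

/-! ### Multiple sums over weakly increasing tuples, built from the least entry. -/

section MultipleSum

/-- Weakly increasing `k`-tuples with entries at least `n`. -/
abbrev MonoTuple (k n : ℕ) : Type := {f : Fin k → ℕ // Monotone f ∧ ∀ i, n ≤ f i}

/-- Prepend the least entry `n + i` to a weakly increasing tuple. -/
def MonoTuple.cons {k n : ℕ} (i : ℕ) (g : MonoTuple k (n + i)) : MonoTuple (k + 1) n :=
  ⟨Fin.cons (n + i) g.1, by
    refine ⟨fun a b hab ↦ ?_, fun a ↦ ?_⟩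
    · induction a using Fin.cases with
      | zero =>
        induction b using Fin.cases with
        | zero => exact le_rfl
        | succ b => simpa using g.2.2 b
      | succ a =>
        induction b using Fin.cases with
        | zero => exact absurd hab (by simp)
        | succ b => simpa using g.2.1 (Fin.succ_le_succ_iff.1 hab)
    · induction a using Fin.cases with
      | zero => simp
      | succ a => simpa using (Nat.le_add_right n i).trans (g.2.2 a)⟩

/-- A nonempty weakly increasing tuple is its least entry followed by its tail. -/
noncomputable def MonoTuple.consEquiv (k n : ℕ) : (Σ i : ℕ, MonoTuple k (n + i)) ≃ MonoTuple (k + 1) n :=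
  Equiv.ofBijective (fun x ↦ MonoTuple.cons x.1 x.2) <| by
    constructor
    · rintro ⟨i, g, hg⟩ ⟨j, g', hg'⟩ h
      have h0 : (Fin.cons (n + i) g : Fin (k + 1) → ℕ) = Fin.cons (n + j) g' :=
        congrArg Subtype.val h
      have h1 := Fin.cons_inj.1 h0
      obtain rfl : i = j := by omega
      obtain rfl : g = g' := h1.2
      rfl
    · rintro ⟨f, hf⟩
      obtain ⟨i, hi⟩ := Nat.exists_eq_add_of_le (hf.2 0)
      refine ⟨⟨i, Fin.tail f, fun a b hab ↦ hf.1 (Fin.succ_le_succ_iff.2 hab), fun a ↦ ?_⟩, ?_⟩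
      · rw [← hi]
        exact hf.1 (Fin.zero_le _)
      · refine Subtype.ext ?_
        change Fin.cons (n + i) (Fin.tail f) = f
        rw [← hi, Fin.cons_self_tail]

theorem summable_monoTuple {k n : ℕ} {F : MonoTuple k n → ℤ⟦X⟧}
    (hF : ∀ f, X ^ (∑ i, f.1 i) ∣ F f) : Summable F := by
  refine summable_of_X_pow_dvd (fun f ↦ ∑ i, f.1 i) (fun d ↦ ?_) hF
  refine Set.Finite.of_finite_image (f := Subtype.val) ?_ Subtype.val_injective.injOn
  refine (Set.Finite.pi' (ι := Fin k) fun _ ↦ Set.finite_le_nat d).subset ?_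
  rintro _ ⟨f, hf, rfl⟩ i
  exact (single_le_sum (fun _ _ ↦ Nat.zero_le _) (mem_univ i)).trans hf

theorem hasSum_monoTuple_succ {k n : ℕ} {F : MonoTuple (k + 1) n → ℤ⟦X⟧} {G : ℕ → ℤ⟦X⟧}
    {a : ℤ⟦X⟧} (hF : ∀ f, X ^ (∑ i, f.1 i) ∣ F f) (hG : HasSum G a)
    (hFG : ∀ i, HasSum (fun g : MonoTuple k (n + i) ↦ F (MonoTuple.cons i g)) (G i)) :
    HasSum F a := by
  rw [← (MonoTuple.consEquiv k n).hasSum_iff]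
  exact HasSum.sigma_of_hasSum hG hFG
    ((MonoTuple.consEquiv k n).summable_iff.2 (summable_monoTuple hF))

theorem X_pow_dvd_prod_lambertTerm {k : ℕ} (f : Fin k → ℕ) :
    X ^ (∑ i, f i) ∣ ∏ i, lambertTerm (f i) := by
  rw [← prod_pow_eq_pow_sum]
  exact prod_dvd_prod_of_dvd _ _ fun i _ ↦ X_pow_dvd_lambertTerm (f i)

/-- Unrolls `hasSum_tailMoment_succ`. The free bound m avoids casts between the tuple types for m +
i and n + i + 1. -/
theorem hasSum_tailMoment (k n : ℕ) {m : ℕ} (hm : m = n + 1) :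
    HasSum (fun f : MonoTuple k m ↦ ∏ i, lambertTerm (f.1 i)) (tailMoment k n) := by
  induction k generalizing n m with
  | zero =>
    rw [tailMoment_zero]
    have : Unique (MonoTuple 0 m) :=
      { default := ⟨fun i ↦ i.elim0, fun i ↦ i.elim0, fun i ↦ i.elim0⟩
        uniq := fun f ↦ Subtype.ext (funext fun i ↦ i.elim0) }
    simp
  | succ k ih =>
    refine hasSum_monoTuple_succ (fun f ↦ X_pow_dvd_prod_lambertTerm f.1)
      (hasSum_tailMoment_succ k n) fun i ↦ ?_
    have hi : m + i = n + i + 1 := by omega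
    refine hasSum_of_eq ((ih (n + i) hi).mul_left (lambertTerm (n + i + 1))) (fun g ↦ ?_) rfl
    rw [MonoTuple.cons, Fin.prod_univ_succ]
    simp only [Fin.cons_zero, Fin.cons_succ, hi]

theorem recip_prod {ι : Type*} (s : Finset ι) {f : ι → ℤ⟦X⟧}
    (hf : ∀ i ∈ s, constantCoeff (f i) = 1) : recip (∏ i ∈ s, f i) = ∏ i ∈ s, recip (f i) := by
  classical
  induction s using Finset.induction_on with
  | empty => simp [recip_one]
  | insert a s ha ih =>
    rw [prod_insert ha, prod_insert ha, recip_mul (hf a (mem_insert_self a s)),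
      ih fun i hi ↦ hf i (mem_insert_of_mem hi)]
    rw [map_prod]
    exact prod_eq_one fun i hi ↦ hf i (mem_insert_of_mem hi)

theorem summand_eq {k : ℕ} (hk : 1 ≤ k) (n : Index k) :
    summand hk n = (∏ i, lambertTerm (n.1 i)) * recip (qpInf (X ^ n.1 ⟨0, hk⟩)) := by
  have hc : ∀ i ∈ (univ : Finset (Fin k)), constantCoeff ((1 - (X : ℤ⟦X⟧) ^ n.1 i) ^ 2) = 1 := by
    intro i _
    have := n.2.2 i
    simp [show n.1 i ≠ 0 by omega]
  rw [summand, qPochInf_eq_qpInf]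
  change _ * recip _ = _
  rw [recip_mul (by rw [map_prod]; exact prod_eq_one hc) (constantCoeff_qpInf _),
    recip_prod _ hc, ← prod_pow_eq_pow_sum]
  simp only [lambertTerm, prod_mul_distrib]
  ring

/-- Only n_1 enters the infinite product, so fixing n_1 = i + 1 leaves the sum `tailMoment k i`. -/
theorem hasSum_summand (k : ℕ) :
    HasSum (fun n : Index (k + 1) ↦ summand (Nat.le_add_left 1 k) n)
      (extract (2 * (k + 1)) (((k + 1 : ℕ) : ℤ) - 1) crankGF -
        extract (2 * (k + 1)) (((k + 1 : ℕ) : ℤ) - 1) rankGF) := by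
  refine hasSum_monoTuple_succ (fun f ↦ ?_) (hasSum_extract_crankGF_sub_rankGF k) fun i ↦ ?_
  · rw [summand_eq]
    exact (X_pow_dvd_prod_lambertTerm f.1).mul_right _
  · have hi : 1 + i = i + 1 := add_comm _ _
    refine hasSum_of_eq ((hasSum_tailMoment k i hi).mul_left
      (lambertTerm (i + 1) * recip (qpInf (X ^ (i + 1))))) (fun g ↦ ?_) rfl
    rw [summand_eq, MonoTuple.cons, Fin.prod_univ_succ]
    simp only [Fin.mk_zero', Fin.cons_zero, Fin.cons_succ, hi]
    ring

end MultipleSum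

/-! ### The case k = 1: Andrews' identity. -/

section SecondMoment

theorem hasSum_spt :
    HasSum (fun n ↦ lambertTerm (n + 1) * recip (qpInf (X ^ (n + 1))))
      (PowerSeries.mk fun d ↦ (spt d : ℤ)) := by
  have h := (hasSum_nat_add_iff' 1).2 (hasSum_fiber (fun s ↦ sInf {a | a ∈ s})
    fun s : Multiset ℕ ↦ (s.count (sInf {a | a ∈ s}) : ℤ))
  simp only [spt_class_series, sum_range_one] at h
  refine hasSum_of_eq h (fun n ↦ rfl) ?_
  -- Index 0 holds only the empty partition, by the default `sInf ∅ = 0`; it contributes nothing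
  -- because 0 is never a part.
  have hz : PowerSeries.mk (fun d ↦ ∑ p : d.Partition, if sInf {a | a ∈ p.parts} = 0 then
      (p.parts.count (sInf {a | a ∈ p.parts}) : ℤ) else 0) = 0 := by
    ext d
    rw [coeff_mk, map_zero]
    refine sum_eq_zero fun p _ ↦ ?_
    split_ifs with h0
    · rw [h0, Nat.cast_eq_zero, Multiset.count_eq_zero]
      exact fun hm ↦ (p.parts_pos hm).false
    · rfl
  rw [hz, sub_zero]
  ext d
  simp [spt]

theorem spt_eq (n : ℕ) : (spt n : ℤ) = mu 2 n - eta 2 n := by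
  have h := hasSum_extract_crankGF_sub_rankGF 0
  simp only [tailMoment_zero, mul_one] at h
  have h1 := congrArg (coeff n) (hasSum_spt.unique h)
  rw [coeff_mk, map_sub] at h1
  rw [h1]
  congr 1
  · exact coeff_extract_crankGF_eq_mu 1 n
  · exact coeff_extract_rankGF_eq_eta 1 n

theorem crankGF_eq : crankGF = PowerSeries.map C (recip (qpInf 1)) * tail 0 := by
  have h := map_C_recip_qpInf 0
  simp only [pow_zero] at h
  rw [h, tail, crankTail_zero, ← crankGF]
  linear_combination (-crankGF) * mul_recip (constantCoeff_qpInf (1 : ℤ⟦X⟧⟦X⟧))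

theorem extract_crankGF (r : ℕ) (e : ℤ) :
    extract r e crankGF = recip (qpInf 1) * extract r e (tail 0) := by
  rw [crankGF_eq, extract_map_mul]

/-- Crank minus rank is a multiple of ε², so the first moments agree, and that of the crank is
binom(0, 1)/(q)_∞ = 0. -/
theorem sum_rank_eq_zero (n : ℕ) : ∑ p : n.Partition, rank p = 0 := by
  have h := hasSum_crankGF_sub_rankGF.map (extract 1 0) (continuous_extract _ _)
  have h0 : (extract 1 0 ∘ fun n ↦ C secondDiff *
      (PowerSeries.map C (lambertTerm (n + 1) * recip (qpInf (X ^ (n + 1)))) * tail n))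
      = fun _ ↦ 0 := by
    ext1 n
    rw [Function.comp_apply, extract_secondDiff_mul_of_lt (by simp)]
  rw [h0] at h
  have h1 := h.unique hasSum_zero
  rw [map_sub, extract_crankGF, extract_tail_of_lt (by simp), Ring.choose_one_right, map_zero,
    mul_zero, zero_sub, neg_eq_zero] at h1
  have h2 := congrArg (coeff n) h1
  rw [coeff_extract_rankGF, map_zero] at h2
  simpa using h2

theorem two_mul_choose_two (m : ℤ) : 2 * Ring.choose m 2 = m * (m - 1) := by
  have h := Ring.descPochhammer_eq_factorial_smul_choose m 2
  simp only [descPochhammer_succ_right, descPochhammer_zero, Nat.cast_zero, Nat.cast_one,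
    sub_zero, one_mul, Polynomial.smeval_mul, Polynomial.smeval_sub, Polynomial.smeval_X,
    Polynomial.smeval_one, pow_one, pow_zero, Nat.factorial_two, nsmul_eq_mul, one_smul]
    at h
  rw [h]
  rfl

/-- m² = m(m - 1) + m, and the linear term sums to 0. -/
theorem two_mul_eta_two (n : ℕ) : 2 * eta 2 n = rankMomentTwo n := by
  have h1 := eta_eq 1 n
  have h2 := sum_mul_N n fun m ↦ m ^ 2
  have h3 := sum_rank_eq_zero n
  rw [rankMomentTwo, h2, ← sub_zero (∑ p, _), ← h3, ← sum_sub_distrib,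
    show eta 2 n = _ from h1, mul_sum]
  refine sum_congr rfl fun p _ ↦ ?_
  have := two_mul_choose_two (rank p)
  simp only [Nat.cast_one, sub_self, add_zero, mul_one]
  linarith

theorem hasSum_count (n : ℕ) (p : n.Partition) :
    HasSum (fun a ↦ ((a + 1 : ℕ) : ℤ) * p.parts.count (a + 1)) n := by
  have h1 := (mem_finsuppAntidiag.1 p.toFinsuppAntidiag_mem_finsuppAntidiag).1
  have h2 : ∑ a ∈ range n, ((a + 1 : ℕ) : ℤ) * p.parts.count (a + 1) = n := by
    rw [← Ico_add_one_right_eq_Icc, sum_Ico_eq_sum_range] at h1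
    conv_rhs => rw [← h1]
    push_cast
    refine sum_congr (by simp) fun a _ ↦ ?_
    simp [Nat.Partition.toFinsuppAntidiag, add_comm, mul_comm]
  rw [← h2]
  refine hasSum_sum_of_ne_finset_zero fun a ha ↦ ?_
  rw [Multiset.count_eq_zero.2, Nat.cast_zero, mul_zero]
  intro hm
  have := Nat.Partition.le_of_mem_parts hm
  exact ha (mem_range.2 (by omega))

/-- n p(n) is the sum of all parts of all partitions of n, sorted here by part size. -/
theorem hasSum_mul_card_partition :
    HasSum (fun a : ℕ ↦ ((a + 1 : ℕ) : ℤ⟦X⟧) * (X ^ (a + 1) * recip (1 - X ^ (a + 1))) *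
      recip (qpInf 1)) (PowerSeries.mk fun d : ℕ ↦ (d : ℤ) * Fintype.card d.Partition) := by
  simp only [← count_series]
  rw [WithPiTopology.hasSum_iff_hasSum_coeff]
  intro d
  simp only [coeff_mk]
  have h := hasSum_sum (s := univ) fun p (_ : p ∈ (univ : Finset d.Partition)) ↦ hasSum_count d p
  rw [sum_const, card_univ, nsmul_eq_mul, mul_comm] at h
  exact h

/-- Both sides are the double series ∑ a q^{ac} over a, c ≥ 1, summed over c first or over a first.
-/
theorem hasSum_lambert :
    HasSum (fun a : ℕ ↦ ((a + 1 : ℕ) : ℤ⟦X⟧) * (X ^ (a + 1) * recip (1 - X ^ (a + 1))))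
      (tailMoment 1 0) := by
  let f : ℕ × ℕ → ℤ⟦X⟧ := fun p ↦ ((p.1 + 1 : ℕ) : ℤ⟦X⟧) * X ^ ((p.1 + 1) * (p.2 + 1))
  have hX : ∀ n : ℕ, (X : ℤ⟦X⟧) ∣ X ^ (n + 1) := fun n ↦ Dvd.intro_left (X ^ n) (by ring)
  have hf : Summable f := by
    refine summable_of_X_pow_dvd (fun p ↦ p.1 + p.2) (fun d ↦ ?_) fun p ↦ ?_
    · refine ((Set.finite_le_nat d).prod (Set.finite_le_nat d)).subset fun p hp ↦ ?_
      simp only [Set.mem_ofPred_eq, Set.mem_prod] at hp ⊢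
      omega
    · exact (pow_dvd_pow X (by nlinarith)).mul_left _
  have hrow : ∀ a, HasSum (fun c ↦ f (a, c))
      (((a + 1 : ℕ) : ℤ⟦X⟧) * (X ^ (a + 1) * recip (1 - X ^ (a + 1)))) := fun a ↦ by
    refine hasSum_of_eq ((hasSum_geometric (hX a)).mul_left _) (fun c ↦ ?_) rfl
    simp only [f, ← pow_mul]
  have hcol : ∀ c, HasSum (fun a ↦ f (a, c)) (lambertTerm (c + 1)) := fun c ↦ by
    refine hasSum_of_eq (hasSum_mul_geometric (hX c)) (fun a ↦ ?_) rfl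
    simp only [f, ← pow_mul, mul_comm (c + 1)]
  have h1 := hf.hasSum.prod_fiberwise hrow
  have h2 := ((Equiv.prodComm ℕ ℕ).hasSum_iff.2 hf.hasSum).prod_fiberwise hcol
  have h3 := hasSum_tailMoment_succ 0 0
  simp only [tailMoment_zero, mul_one, zero_add] at h3
  rwa [h2.unique h3] at h1

theorem mu_two (n : ℕ) : mu 2 n = (n : ℤ) * Fintype.card n.Partition := by
  have h1 := hasSum_mul_card_partition.unique (hasSum_lambert.mul_right (recip (qpInf 1)))
  have h2 := congrArg (coeff n) h1
  rw [coeff_mk, tailMoment, mul_comm (extract _ _ _), ← extract_crankGF, coeff_extract_crankGF_eq_mu] at h2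
  exact h2.symm

theorem mu_zero_eq_eta_zero (k : ℕ) : mu (2 * k) 0 = eta (2 * k) 0 := by
  rw [mu_eq, eta_eq, if_neg zero_ne_one, add_zero]
  refine sum_congr rfl fun p _ ↦ ?_
  simp [crank, rank]

end SecondMoment

end SptK

theorem mainTheorem1 :
    (∀ (k : ℕ) (hk : 1 ≤ k),
      HasSum (fun n : SptK.Index k => SptK.summand hk n)
        (PowerSeries.mk fun n : ℕ =>
          if 1 ≤ n then SptK.mu (2 * k) n - SptK.eta (2 * k) n else 0)) ∧
    (∀ n : ℕ, 1 ≤ n →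
      (SptK.spt n : ℚ) =
        (n : ℚ) * (Fintype.card n.Partition : ℚ) - (SptK.rankMomentTwo n : ℚ) / 2) := by
  refine ⟨fun k hk ↦ ?_, fun n _ ↦ ?_⟩
  · obtain ⟨k, rfl⟩ := Nat.exists_eq_add_of_le' hk
    refine SptK.hasSum_of_eq (SptK.hasSum_summand k) (fun n ↦ rfl) ?_
    ext d
    rw [coeff_mk, map_sub, SptK.coeff_extract_crankGF_eq_mu, SptK.coeff_extract_rankGF_eq_eta]
    split_ifs with hd
    · rfl
    · obtain rfl : d = 0 := by omega
      -- The moment series starts at n = 1; at n = 0 the empty partition has rank and crank 0, so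
      -- nothing is lost.
      rw [SptK.mu_zero_eq_eta_zero, sub_self]
  · have h1 := SptK.spt_eq n
    rw [SptK.mu_two] at h1
    have h1' : (SptK.spt n : ℚ) = n * Fintype.card n.Partition - SptK.eta 2 n := by
      exact_mod_cast h1
    have h2 : (2 : ℚ) * SptK.eta 2 n = SptK.rankMomentTwo n := by
      exact_mod_cast SptK.two_mul_eta_two n
    rw [h1', ← h2]
    ring
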